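/- **Setting.** Let $n\ge 1$ and let $\Omega\subset\mathbb R^n$ be open and bounded. $H^1_0(\Omega)$ is the closure of $\mathscr D(\Omega)=C_c^\infty(\Omega)$ in $H^1(\Omega)$, $H^{-1}(\Omega)$ is its dual, and $\mathcal U=H^2(\Omega)\cap H^1_0(\Omega)$ with the $H^2$ norm. $\mathcal M(\Omega)$ is the space of finite regular signed Borel measures on $\Omega$, the dual of $C_0(\Omega)$. $(\cdot,\cdot)$ is the inner product of $L^2(\Omega)$ and $\langle\cdot,\cdot\rangle$ the pairing of $H^{-1}(\Omega)$ with $H^1_0(\Omega)$. Let $$a(u,v)=\sum_{i,j=1}^n\int_\Omega a_{ij}\,\partial_iu\,\partial_jv\,dx+\sum_{i=1}^n\int_\Omega a_i\,\partial_iu\,v\,dx+\int_\Omega a_0\,u\,v\,dx ,$$ where $a_{ij},a_i,a_0\in L^\infty(\Omega)$, $a_0\ge0$ a.e., $\sum_{i,j}a_{ij}\theta_i\theta_j\ge m\sum_i\theta_i^2$ for a.e. $x\in\Omega$ and all $\theta\in\mathbb R^n$, with some $m>0$, and $a$ is coercive: $a(u,u)\ge m'\|u\|_{H^1}^2$ for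 all $u\in H^1_0(\Omega)$, with some $m'>0$. Let $A,A^*:H^1_0(\Omega)\to H^{-1}(\Omega)$ be given by $\langle Au,v\rangle=a(u,v)$ and $\langle A^*p,w\rangle=a(w,p)$. Let $f,z\in L^2(\Omega)$, $\nu>0$, and let $\mathcal U_{ad}\subset\mathcal U$ be closed and convex. For $\varphi\in\mathcal U$ let $\mathcal T(\varphi)$ be the solution $y\in\mathcal K(\varphi)=\{v\in H^1_0(\Omega): v\ge\varphi \text{ a.e.}\}$ of $a(y,v-y)\ge(f,v-y)$ for all $v\in\mathcal K(\varphi)$. For $\delta>0$ let $$\beta_\delta(r)=\frac1\delta\begin{cases}0,&r\ge0\\-r^2,&-\frac12\le r\le0\\ r+\frac14,&r\le-\frac12\end{cases}\qquad \beta_\delta'(r)=\frac1\delta\begin{cases}0,&r\ge0\\-2r,&-\frac12\le r\le0\\ 1,&r\le-\frac12,\end{cases}$$ and let $\mathcal T^\delta(\varphi)$ be the weak solution $y\in H^1_0(\Omega)$ of $Ay+\beta_\delta(y-\varphi)=f$. Let $\varphi^*$ minimize $J(\varphi)=\frac12\|\mathcal T(\varphi)-z\|_{L^2}^2+\frac\nu2\|\Delta\varphi\|_{L^2}^2$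 over $\mathcal U_{ad}$, and let $y^*=\mathcal T(\varphi^*)$. For every $\delta>0$ let $\varphi^\delta$ minimize $$J_\delta(\varphi)=\tfrac12\left[\|\mathcal T^\delta(\varphi)-z\|_{L^2}^2+\nu\|\Delta\varphi\|_{L^2}^2+\|\varphi-\varphi^*\|_{L^2}^2\right]$$ over $\mathcal U_{ad}$, let $y^\delta=\mathcal T^\delta(\varphi^\delta)$, let $p^\delta\in H^1_0(\Omega)$ be the weak solution of the adjoint equation $A^*p^\delta+\beta_\delta'(y^\delta-\varphi^\delta)\,p^\delta=y^\delta-z$, and let $\mu^\delta=\beta_\delta'(y^\delta-\varphi^\delta)\,p^\delta$. **Theorem.** There is a constant $C$, independent of $\delta$, with $\|\mu^\delta\|_{L^1(\Omega)}\le C$ for all $\delta>0$. Moreover, as $\delta\to0$, up to extraction of subsequences, $p^\delta$ converges to some $p^*$ weakly in $H^1_0(\Omega)$ and $\mu^\delta$ converges to some $\mu^*$ weakly-* in $H^{-1}(\Omega)\cap\mathcal M(\Omega)$: every sequence $\delta_k\to0$, $\delta_k>0$, has a subsequence along which * $p^{\delta}\rightharpoonup p^*$ weakly in $H^1_0(\Omega)$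 for some $p^*\in H_0^1(\Omega)$; * for some $\mu^*\in H^{-1}(\Omega)\cap\mathcal M(\Omega)$ (that is, a functional $\mu^*\in H^{-1}(\Omega)$ and a measure $m\in\mathcal M(\Omega)$ with $\langle\mu^*,w\rangle=\int_\Omega w\,dm$ for all $w\in H^1_0(\Omega)\cap C_0(\Omega)$), $\int_\Omega\mu^\delta w\,dx\to\langle\mu^*,w\rangle$ for all $w\in H^1_0(\Omega)$ and $\int_\Omega\mu^\delta g\,dx\to\int_\Omega g\,dm$ for all $g\in C_0(\Omega)$; * the limits satisfy $$A^*p^*+\mu^*=y^*-z\ \text{ in } H^{-1}(\Omega),\qquad \langle\mu^*,p^*\rangle\ge0 .$$ -/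

import Mathlib

open MeasureTheory Filter Topology TopologicalSpace
open scoped ENNReal Distributions ZeroAtInfty

noncomputable section

namespace ObstacleControl

/-- The Euclidean space `ℝⁿ`. -/
abbrev Space (n : ℕ) : Type := EuclideanSpace ℝ (Fin n)

variable {n : ℕ}

/-- `L²(Ω)`, with its usual inner product and norm. -/
abbrev L2 (Ω : Opens (Space n)) : Type := Lp ℝ 2 (volume.restrict (Ω : Set (Space n)))

/-- The classical partial derivative `∂ᵢψ`. -/
def partialDeriv (i : Fin n) (ψ : Space n → ℝ) (x : Space n) : ℝ :=
  fderiv ℝ ψ x (EuclideanSpace.single i 1)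

/-- `g` is the weak partial derivative `∂ᵢu` of `u` in `Ω`. -/
def HasWeakPartial (Ω : Opens (Space n)) (i : Fin n) (u g : L2 Ω) : Prop :=
  ∀ ψ : 𝓓(Ω, ℝ),
    ∫ x in (Ω : Set (Space n)), u x * partialDeriv i ψ x
      = - ∫ x in (Ω : Set (Space n)), g x * ψ x

/-- Pairs `(u, (g₁, …, gₙ))` in `L²(Ω) × L²(Ω)ⁿ` with norm
`(‖u‖² + ∑ᵢ ‖gᵢ‖²)^{1/2}`; on pairs `(u, ∇u)` this is the `H¹(Ω)` norm. -/
abbrev Jet1 (Ω : Opens (Space n)) : Type :=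
  WithLp 2 (L2 Ω × PiLp 2 (fun _ : Fin n => L2 Ω))

/-- The pairs `(ψ, ∇ψ)` with `ψ ∈ 𝓓(Ω)`. -/
def testJets (Ω : Opens (Space n)) : Set (Jet1 Ω) :=
  {U | ∃ ψ : 𝓓(Ω, ℝ),
    (U.fst : Space n → ℝ) =ᵐ[volume.restrict (Ω : Set (Space n))] ψ ∧
    ∀ i, (U.snd i : Space n → ℝ) =ᵐ[volume.restrict (Ω : Set (Space n))] partialDeriv i ψ}

/-- `H₀¹(Ω)`: the closure of `𝓓(Ω)` in the `H¹(Ω)` norm. An element is the pair `(u, ∇u)` of a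
function and its weak gradient. (`testJets Ω` is itself a linear subspace, so taking the span
adds nothing.) -/
def H10 (Ω : Opens (Space n)) : Submodule ℝ (Jet1 Ω) :=
  (Submodule.span ℝ (testJets Ω)).topologicalClosure

/-- The `L²` function underlying an element of `H₀¹(Ω)`. -/
def fn {Ω : Opens (Space n)} (u : H10 Ω) : L2 Ω := (u : Jet1 Ω).fst

/-- The weak partial derivative `∂ᵢu` of an element of `H₀¹(Ω)`. -/
def grad {Ω : Opens (Space n)} (u : H10 Ω) (i : Fin n) : L2 Ω := (u : Jet1 Ω).snd i

/-- `H⁻¹(Ω)`, the dual of `H₀¹(Ω)`. -/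
abbrev HNeg1 (Ω : Opens (Space n)) : Type := StrongDual ℝ (H10 Ω)

theorem integrable_mul_test {Ω : Opens (Space n)} (u : L2 Ω) {η : Space n → ℝ}
    (hc : Continuous η) (hs : HasCompactSupport η) :
    Integrable (fun x => u x * η x) (volume.restrict (Ω : Set (Space n))) :=
  MemLp.integrable_mul (p := 2) (q := 2) (Lp.memLp u) (hc.memLp_of_hasCompactSupport hs)

theorem continuous_partialDeriv {Ω : Opens (Space n)} (i : Fin n) (ψ : 𝓓(Ω, ℝ)) :
    Continuous (partialDeriv i ψ) :=
  (ψ.contDiff.continuous_fderiv (by simp)).clm_apply continuous_const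

theorem hasCompactSupport_partialDeriv {Ω : Opens (Space n)} (i : Fin n) (ψ : 𝓓(Ω, ℝ)) :
    HasCompactSupport (partialDeriv i ψ) :=
  (ψ.hasCompactSupport.fderiv (𝕜 := ℝ)).comp_left
    (g := fun L : Space n →L[ℝ] ℝ => L (EuclideanSpace.single i 1)) rfl

theorem HasWeakPartial.zero {Ω : Opens (Space n)} (i : Fin n) :
    HasWeakPartial Ω i (0 : L2 Ω) 0 := by
  intro ψ
  have h := Lp.coeFn_zero ℝ 2 (volume.restrict (Ω : Set (Space n)))
  rw [integral_eq_zero_of_ae, integral_eq_zero_of_ae, neg_zero]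
  · filter_upwards [h] with x hx
    rw [hx]
    simp
  · filter_upwards [h] with x hx
    rw [hx]
    simp

theorem HasWeakPartial.add {Ω : Opens (Space n)} {i : Fin n} {u v g h : L2 Ω}
    (hu : HasWeakPartial Ω i u g) (hv : HasWeakPartial Ω i v h) :
    HasWeakPartial Ω i (u + v) (g + h) := by
  intro ψ
  have key : ∀ (a b : L2 Ω) {η : Space n → ℝ}, Continuous η → HasCompactSupport η →
      ∫ x in (Ω : Set (Space n)), (a + b : L2 Ω) x * η x
        = (∫ x in (Ω : Set (Space n)), a x * η x)
          + ∫ x in (Ω : Set (Space n)), b x * η x := by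
    intro a b η hc hs
    rw [← integral_add (integrable_mul_test a hc hs) (integrable_mul_test b hc hs)]
    refine integral_congr_ae ?_
    filter_upwards [Lp.coeFn_add a b] with x hx
    rw [hx, Pi.add_apply, add_mul]
  rw [key _ _ (continuous_partialDeriv i ψ) (hasCompactSupport_partialDeriv i ψ),
    key _ _ ψ.continuous ψ.hasCompactSupport, hu ψ, hv ψ, neg_add]

theorem HasWeakPartial.smul {Ω : Opens (Space n)} {i : Fin n} {u g : L2 Ω} (c : ℝ)
    (hu : HasWeakPartial Ω i u g) : HasWeakPartial Ω i (c • u) (c • g) := by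
  intro ψ
  have key : ∀ (a : L2 Ω) (η : Space n → ℝ),
      ∫ x in (Ω : Set (Space n)), (c • a : L2 Ω) x * η x
        = c * ∫ x in (Ω : Set (Space n)), a x * η x := by
    intro a η
    rw [← integral_const_mul]
    refine integral_congr_ae ?_
    filter_upwards [Lp.coeFn_smul c a] with x hx
    rw [hx, Pi.smul_apply, smul_eq_mul, mul_assoc]
  rw [key, key, hu ψ, mul_neg]

/-- The control space `𝒰 = H²(Ω) ∩ H₀¹(Ω)`. An element is a triple `(u, ∇u, D²u)` with
`(u, ∇u) ∈ H₀¹(Ω)` and with the weak second derivatives `∂ⱼ∂ᵢu = D (i, j)` in `L²(Ω)`. The norm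
inherited from the ambient space is the `H²(Ω)` norm. -/
def H2H10 (Ω : Opens (Space n)) :
    Submodule ℝ (WithLp 2 (H10 Ω × PiLp 2 (fun _ : Fin n × Fin n => L2 Ω))) where
  carrier := {U | ∀ i j, HasWeakPartial Ω j (grad U.fst i) (U.snd (i, j))}
  zero_mem' := fun _ j => HasWeakPartial.zero j
  add_mem' := fun hU hV i j => (hU i j).add (hV i j)
  smul_mem' := fun c _ hU i j => (hU i j).smul c

/-- The inclusion `𝒰 ⊆ H₀¹(Ω)`. -/
def toH10 {Ω : Opens (Space n)} (φ : H2H10 Ω) : H10 Ω :=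
  (φ : WithLp 2 (H10 Ω × PiLp 2 (fun _ : Fin n × Fin n => L2 Ω))).fst

/-- The Laplacian `Δφ ∈ L²(Ω)` of `φ ∈ 𝒰`. -/
def lap {Ω : Opens (Space n)} (φ : H2H10 Ω) : L2 Ω :=
  ∑ i, (φ : WithLp 2 (H10 Ω × PiLp 2 (fun _ : Fin n × Fin n => L2 Ω))).snd (i, i)

/-- The coefficients `aᵢⱼ`, `aᵢ`, `a₀` of the operator. -/
structure Coeffs (n : ℕ) where
  /-- the second order coefficients `aᵢⱼ` -/
  a : Fin n → Fin n → Space n → ℝ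
  /-- the first order coefficients `aᵢ` -/
  b : Fin n → Space n → ℝ
  /-- the zeroth order coefficient `a₀` -/
  c : Space n → ℝ

/-- The bilinear form
`a(u,v) = ∑ᵢⱼ ∫ aᵢⱼ ∂ᵢu ∂ⱼv + ∑ᵢ ∫ aᵢ ∂ᵢu v + ∫ a₀ u v = ⟨Au, v⟩` on `H₀¹(Ω)`. -/
def form {Ω : Opens (Space n)} (K : Coeffs n) (u v : H10 Ω) : ℝ :=
  (∑ i, ∑ j, ∫ x in (Ω : Set (Space n)), K.a i j x * grad u i x * grad v j x)
    + (∑ i, ∫ x in (Ω : Set (Space n)), K.b i x * grad u i x * fn v x)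
    + ∫ x in (Ω : Set (Space n)), K.c x * fn u x * fn v x

/-- The adjoint form `a*(p,w) = a(w,p) = ⟨A*p, w⟩`. -/
def adjForm {Ω : Opens (Space n)} (K : Coeffs n) (p w : H10 Ω) : ℝ := form K w p

/-- Boundedness of the coefficients on `Ω`, uniform ellipticity, nonnegativity of `a₀`, and
coercivity of the form on `H₀¹(Ω)`. -/
structure Coeffs.Admissible (K : Coeffs n) (Ω : Opens (Space n)) : Prop where
  bdd_a : ∀ i j, MemLp (K.a i j) ∞ (volume.restrict (Ω : Set (Space n)))
  bdd_b : ∀ i, MemLp (K.b i) ∞ (volume.restrict (Ω : Set (Space n)))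
  bdd_c : MemLp K.c ∞ (volume.restrict (Ω : Set (Space n)))
  elliptic : ∃ m : ℝ, 0 < m ∧ ∀ᵐ x ∂(volume.restrict (Ω : Set (Space n))), ∀ θ : Fin n → ℝ,
    m * ∑ i, θ i ^ 2 ≤ ∑ i, ∑ j, K.a i j x * θ i * θ j
  nonneg_c : ∀ᵐ x ∂(volume.restrict (Ω : Set (Space n))), 0 ≤ K.c x
  coercive : ∃ m : ℝ, 0 < m ∧ ∀ u : H10 Ω, m * ‖u‖ ^ 2 ≤ form K u u

/-- The convex set `𝒦(φ) = {y ∈ H₀¹(Ω) | y ≥ φ a.e. in Ω}`. -/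
def obstacleSet {Ω : Opens (Space n)} (φ : H10 Ω) : Set (H10 Ω) :=
  {y | (fn φ : Space n → ℝ) ≤ᵐ[volume.restrict (Ω : Set (Space n))] fn y}

/-- `y = 𝒯(φ)`: `y ∈ 𝒦(φ)` solves the obstacle problem
`a(y, v - y) ≥ (f, v - y)` for all `v ∈ 𝒦(φ)`. -/
def IsObstacleState {Ω : Opens (Space n)} (K : Coeffs n) (f : L2 Ω) (φ y : H10 Ω) : Prop :=
  y ∈ obstacleSet φ ∧ ∀ v ∈ obstacleSet φ, inner ℝ f (fn (v - y)) ≤ form K y (v - y)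

/-- The penalization function `β_δ`. -/
def beta (δ r : ℝ) : ℝ :=
  (1 / δ) * (if 0 ≤ r then 0 else if -(1 / 2) ≤ r then -r ^ 2 else r + 1 / 4)

/-- The derivative `β_δ'`. -/
def betaDeriv (δ r : ℝ) : ℝ :=
  (1 / δ) * (if 0 ≤ r then 0 else if -(1 / 2) ≤ r then -2 * r else 1)

/-- `y = 𝒯^δ(φ)`: `y ∈ H₀¹(Ω)` is the weak solution of `A y + β_δ(y - φ) = f`. -/
def IsPenalizedState {Ω : Opens (Space n)} (K : Coeffs n) (f : L2 Ω) (δ : ℝ) (φ y : H10 Ω) :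
    Prop :=
  ∀ v : H10 Ω, form K y v
      + ∫ x in (Ω : Set (Space n)), beta δ (fn y x - fn φ x) * fn v x
    = inner ℝ f (fn v)

/-- The function `μ^δ = β_δ'(y - φ) p`. -/
def multiplier {Ω : Opens (Space n)} (δ : ℝ) (φ y p : H10 Ω) (x : Space n) : ℝ :=
  betaDeriv δ (fn y x - fn φ x) * fn p x

/-- `p ∈ H₀¹(Ω)` is the weak solution of the adjoint equation
`A* p + β_δ'(y - φ) p = y - z`. -/
def IsAdjointState {Ω : Opens (Space n)} (K : Coeffs n) (z : L2 Ω) (δ : ℝ) (φ y p : H10 Ω) :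
    Prop :=
  ∀ w : H10 Ω, adjForm K p w
      + ∫ x in (Ω : Set (Space n)), multiplier δ φ y p x * fn w x
    = inner ℝ (fn y - z) (fn w)

/-- `J = ½ ‖y - z‖² + (ν/2) ‖Δφ‖²` for the control `φ` with state `y`. -/
def cost {Ω : Opens (Space n)} (z : L2 Ω) (ν : ℝ) (φ : H2H10 Ω) (y : H10 Ω) : ℝ :=
  1 / 2 * ‖fn y - z‖ ^ 2 + ν / 2 * ‖lap φ‖ ^ 2

/-- `J_δ = ½ (‖y - z‖² + ν ‖Δφ‖² + ‖φ - φ*‖²)`, with `L²` norms, for the control `φ` with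
penalized state `y`. -/
def penalizedCost {Ω : Opens (Space n)} (z : L2 Ω) (ν : ℝ) (φstar φ : H2H10 Ω) (y : H10 Ω) : ℝ :=
  1 / 2 * (‖fn y - z‖ ^ 2 + ν * ‖lap φ‖ ^ 2 + ‖fn (toH10 φ) - fn (toH10 φstar)‖ ^ 2)

/-- `φ` is an optimal control, with optimal state `y = 𝒯(φ)`, of
`(P) : min {J(φ) | φ ∈ 𝒰_ad}`. -/
def IsOptimal {Ω : Opens (Space n)} (K : Coeffs n) (f z : L2 Ω) (ν : ℝ) (Uad : Set (H2H10 Ω))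
    (φ : H2H10 Ω) (y : H10 Ω) : Prop :=
  φ ∈ Uad ∧ IsObstacleState K f (toH10 φ) y ∧
    ∀ ψ ∈ Uad, ∀ w : H10 Ω, IsObstacleState K f (toH10 ψ) w → cost z ν φ y ≤ cost z ν ψ w

/-- `φ` is an optimal control, with optimal state `y = 𝒯^δ(φ)`, of
`(P^δ) : min {J_δ(φ) | φ ∈ 𝒰_ad}`. -/
def IsPenalizedOptimal {Ω : Opens (Space n)} (K : Coeffs n) (f z : L2 Ω) (ν : ℝ)
    (Uad : Set (H2H10 Ω)) (φstar : H2H10 Ω) (δ : ℝ) (φ : H2H10 Ω) (y : H10 Ω) : Prop :=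
  φ ∈ Uad ∧ IsPenalizedState K f δ (toH10 φ) y ∧
    ∀ ψ ∈ Uad, ∀ w : H10 Ω, IsPenalizedState K f δ (toH10 ψ) w →
      penalizedCost z ν φstar φ y ≤ penalizedCost z ν φstar ψ w

/-- Lebesgue measure on (the subtype) `Ω`. -/
def volOn (Ω : Opens (Space n)) : Measure Ω := Measure.comap Subtype.val volume

/-- The integral `∫ g dm` against a finite signed measure. -/
def signedIntegral {X : Type*} [MeasurableSpace X] (m : SignedMeasure X) (g : X → ℝ) : ℝ :=
  ∫ x, g x ∂m.toJordanDecomposition.posPart - ∫ x, g x ∂m.toJordanDecomposition.negPart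

/-- An element of `H⁻¹(Ω) ∩ ℳ(Ω)`: the functional `ℓ ∈ H⁻¹(Ω)` and the finite signed Borel
measure `m` on `Ω` agree on `H₀¹(Ω) ∩ C₀(Ω)`. (A finite Borel measure on an open subset of `ℝⁿ`
is automatically regular.) -/
def IsRepresentedBy {Ω : Opens (Space n)} (ℓ : HNeg1 Ω) (m : SignedMeasure Ω) : Prop :=
  ∀ (w : H10 Ω) (g : C₀(Ω, ℝ)), (fun x : Ω => fn w (x : Space n)) =ᵐ[volOn Ω] g →
    ℓ w = signedIntegral m g

end ObstacleControl

end

noncomputable section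

namespace ObstacleControl

variable {n : ℕ} {Ω : Opens (Space n)}

/-! The `L¹` bound comes from testing the adjoint equation with `arctan (N p)`, a smooth bounded
approximation of `(π/2) sign p`. Ellipticity and `a₀ ≥ 0` make the second and zeroth order terms
nonnegative. The first order term carries the factor `S'(p) p`, with `S t = arctan (N t)`; this
factor is bounded by 1 and tends to 0 as `N → ∞`. What remains bounds `‖μ^δ‖_{L¹}` by `2 |Ω|^{1/2}
‖y^δ - z‖` (`IsAdjointState.integral_abs_multiplier_le`). Comparing `J_δ(φ^δ)` with `J_δ(φ*)` bounds
`φ^δ` and `Δφ^δ` in `L²`, hence `φ^δ` in `H¹` by Green's formula, hence `y^δ`, hence `p^δ` by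
coercivity (`exists_uniform_bounds`).

The crux of the limit is `y^δ ⇀ y*`. No bound on the second derivatives of `φ^δ` is available, only
one on `Δφ^δ`, so weak limits `(φ₀, l)` are taken of the pairs `(φ^δ, Δφ^δ)` in `H₀¹ × L²`, and `φ₀`
is not known to be an admissible control. Green's formula and Rellich's theorem give `φ^δ → φ₀`
strongly in `H₀¹` (`tendsto_toH10`), so the limit `y₀` of `y^δ` solves the obstacle problem over
`φ₀` (`isObstacleState_of_tendsto`). Mazur's lemma and the continuity of `𝒯` still give `J(φ*) ≤
½‖y₀ - z‖² + (ν/2)‖l‖²` (`IsOptimal.cost_le_of_weak`). Together with `J_δ(φ^δ) ≤ J_δ(φ*)`, the extra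
term `‖φ - φ*‖²` forces `φ₀ = φ*` and `y₀ = y*` (`IsOptimal.eq_of_weak`).

The adjoint equation is linear in `(p, μ)`, so `μ^δ = y^δ - z - A*p^δ` converges against every
element of `H₀¹`, and the `L¹` bound gives a limit measure; both are limits of the same integrals.
The sign follows from `∫ μ^δ p^δ ≥ 0` and weak lower semicontinuity of `a(p,p)`. -/

/-! ### `H₀¹(Ω)` as a separable Hilbert space -/

/-- The map `u ↦ u` from `H₀¹(Ω)` to `L²(Ω)` as a continuous linear map. -/
def fnL (Ω : Opens (Space n)) : H10 Ω →L[ℝ] L2 Ω :=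
  (WithLp.fstL 2 ℝ (L2 Ω) (PiLp 2 (fun _ : Fin n => L2 Ω))).comp (H10 Ω).subtypeL

/-- The map `u ↦ ∂ᵢu` from `H₀¹(Ω)` to `L²(Ω)` as a continuous linear map. -/
def gradL (Ω : Opens (Space n)) (i : Fin n) : H10 Ω →L[ℝ] L2 Ω :=
  (PiLp.proj 2 (fun _ : Fin n => L2 Ω) i).comp
    ((WithLp.sndL 2 ℝ (L2 Ω) (PiLp 2 (fun _ : Fin n => L2 Ω))).comp (H10 Ω).subtypeL)

theorem fnL_apply (u : H10 Ω) : fnL Ω u = fn u := rfl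

theorem gradL_apply (u : H10 Ω) (i : Fin n) : gradL Ω i u = grad u i := rfl

theorem fn_add (u v : H10 Ω) : fn (u + v) = fn u + fn v := rfl

theorem fn_sub (u v : H10 Ω) : fn (u - v) = fn u - fn v := rfl

theorem grad_sub (u v : H10 Ω) (i : Fin n) : grad (u - v) i = grad u i - grad v i := rfl

theorem norm_sq_eq (u : H10 Ω) : ‖u‖ ^ 2 = ‖fn u‖ ^ 2 + ∑ i, ‖grad u i‖ ^ 2 := by
  have h := WithLp.prod_norm_sq_eq_of_L2 (u : Jet1 Ω)
  rw [PiLp.norm_sq_eq_of_L2] at h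
  exact h

theorem norm_fn_le (u : H10 Ω) : ‖fn u‖ ≤ ‖u‖ := by
  refine (sq_le_sq₀ (norm_nonneg _) (norm_nonneg _)).1 ?_
  rw [norm_sq_eq]
  have : 0 ≤ ∑ i, ‖grad u i‖ ^ 2 := Finset.sum_nonneg fun i _ => sq_nonneg _
  linarith

instance : CompleteSpace (H10 Ω) :=
  (Submodule.isClosed_topologicalClosure _).completeSpace_coe

/-- Separability is what turns weak compactness of balls into convergent subsequences. -/
instance : SecondCountableTopology (L2 Ω) := by
  have : Fact ((2 : ℝ≥0∞) ≠ ∞) := ⟨by simp⟩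
  infer_instance

instance : SecondCountableTopology (H10 Ω) := by
  have : SecondCountableTopology (PiLp 2 (fun _ : Fin n => L2 Ω)) :=
    (PiLp.homeomorph 2 (fun _ : Fin n => L2 Ω)).secondCountableTopology
  have : SecondCountableTopology (Jet1 Ω) :=
    (WithLp.homeomorphProd 2 (L2 Ω) (PiLp 2 (fun _ : Fin n => L2 Ω))).secondCountableTopology
  infer_instance

/-! ### Continuity of the bilinear form -/

theorem integrable_mul (u v : L2 Ω) :
    Integrable (fun x => u x * v x) (volume.restrict (Ω : Set (Space n))) :=
  MemLp.integrable_mul (p := 2) (q := 2) (Lp.memLp u) (Lp.memLp v)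

theorem integral_mul_eq_inner (u v : L2 Ω) :
    ∫ x in (Ω : Set (Space n)), u x * v x = inner ℝ u v := by
  rw [L2.inner_def]
  refine integral_congr_ae (Eventually.of_forall fun x => ?_)
  simp [mul_comm]

theorem integrable_weight_mul {a : Space n → ℝ}
    (ha : MemLp a ∞ (volume.restrict (Ω : Set (Space n)))) (g h : L2 Ω) :
    Integrable (fun x => a x * g x * h x) (volume.restrict (Ω : Set (Space n))) := by
  have h1 : MemLp (fun x => a x * g x) 2 (volume.restrict (Ω : Set (Space n))) :=
    MemLp.mul (p := ∞) (q := 2) (r := 2) (Lp.memLp g) ha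
  exact MemLp.integrable_mul (p := 2) (q := 2) h1 (Lp.memLp h)

theorem exists_weight_bilin {a : Space n → ℝ}
    (ha : MemLp a ∞ (volume.restrict (Ω : Set (Space n)))) :
    ∃ B : L2 Ω →L[ℝ] L2 Ω →L[ℝ] ℝ, ∀ g h,
      B g h = ∫ x in (Ω : Set (Space n)), a x * g x * h x := by
  obtain ⟨C, hC0, hC⟩ : ∃ C : ℝ, 0 ≤ C ∧
      ∀ᵐ x ∂(volume.restrict (Ω : Set (Space n))), ‖a x‖ ≤ C := by
    refine ⟨(eLpNorm a ∞ (volume.restrict (Ω : Set (Space n)))).toReal,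
      ENNReal.toReal_nonneg, ?_⟩
    rw [eLpNorm_exponent_top]
    filter_upwards [ae_le_eLpNormEssSup (f := a) (μ := volume.restrict (Ω : Set (Space n)))]
      with x hx
    have hlt := ha.2
    rw [eLpNorm_exponent_top] at hlt
    have := ENNReal.toReal_mono hlt.ne hx
    simpa using this
  refine ⟨LinearMap.mkContinuous₂ (LinearMap.mk₂ ℝ
    (fun g h : L2 Ω => ∫ x in (Ω : Set (Space n)), a x * g x * h x) ?_ ?_ ?_ ?_) C ?_, ?_⟩
  · intro g g' h
    rw [← integral_add (integrable_weight_mul ha g h) (integrable_weight_mul ha g' h)]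
    refine integral_congr_ae ?_
    filter_upwards [Lp.coeFn_add g g'] with x hx
    rw [hx, Pi.add_apply]; ring
  · intro c g h
    rw [smul_eq_mul, ← integral_const_mul]
    refine integral_congr_ae ?_
    filter_upwards [Lp.coeFn_smul c g] with x hx
    rw [hx, Pi.smul_apply, smul_eq_mul]; ring
  · intro g h h'
    rw [← integral_add (integrable_weight_mul ha g h) (integrable_weight_mul ha g h')]
    refine integral_congr_ae ?_
    filter_upwards [Lp.coeFn_add h h'] with x hx
    rw [hx, Pi.add_apply]; ring
  · intro c g h
    rw [smul_eq_mul, ← integral_const_mul]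
    refine integral_congr_ae ?_
    filter_upwards [Lp.coeFn_smul c h] with x hx
    rw [hx, Pi.smul_apply, smul_eq_mul]; ring
  · intro g h
    -- Taking `|g|` and `|h|` as elements of `L²` reduces the bound to Cauchy–Schwarz for the inner
    -- product.
    have hn : ∀ u : L2 Ω, ∃ v : L2 Ω, ‖v‖ = ‖u‖ ∧
        (v : Space n → ℝ) =ᵐ[volume.restrict (Ω : Set (Space n))] fun x => ‖u x‖ := by
      intro u
      refine ⟨(Lp.memLp u).norm.toLp _, ?_, MemLp.coeFn_toLp _⟩
      rw [Lp.norm_toLp, Lp.norm_def, eLpNorm_norm]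
    obtain ⟨g', hg, hg'⟩ := hn g
    obtain ⟨h', hh, hh'⟩ := hn h
    calc ‖∫ x in (Ω : Set (Space n)), a x * g x * h x‖
        ≤ ∫ x in (Ω : Set (Space n)), C * (g' x * h' x) := by
          refine norm_integral_le_of_norm_le ((integrable_mul g' h').const_mul C) ?_
          filter_upwards [hC, hg', hh'] with x h1 h2 h3
          rw [h2, h3, norm_mul, norm_mul, mul_assoc]
          gcongr
      _ = C * inner ℝ g' h' := by rw [integral_const_mul, integral_mul_eq_inner]
      _ ≤ C * ‖g‖ * ‖h‖ := by
          rw [mul_assoc, ← hg, ← hh]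
          gcongr
          exact real_inner_le_norm _ _
  · intro g h
    rfl

theorem exists_form_bilin {K : Coeffs n} (hK : K.Admissible Ω) :
    ∃ A : H10 Ω →L[ℝ] H10 Ω →L[ℝ] ℝ, ∀ u v, A u v = form K u v := by
  choose Ba hBa using fun i j => exists_weight_bilin (hK.bdd_a i j)
  choose Bb hBb using fun i => exists_weight_bilin (hK.bdd_b i)
  obtain ⟨Bc, hBc⟩ := exists_weight_bilin hK.bdd_c
  refine ⟨(∑ i, ∑ j, (Ba i j).bilinearComp (gradL Ω i) (gradL Ω j))
    + (∑ i, (Bb i).bilinearComp (gradL Ω i) (fnL Ω))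
    + Bc.bilinearComp (fnL Ω) (fnL Ω), fun u v => ?_⟩
  simp [form, hBa, hBb, hBc, fnL_apply, gradL_apply]

/-! ### Density of test functions -/

/-- `v` is the element of `H₀¹(Ω)` given by the test function `ψ`. -/
def IsJetOf (v : H10 Ω) (ψ : 𝓓(Ω, ℝ)) : Prop :=
  (fn v : Space n → ℝ) =ᵐ[volume.restrict (Ω : Set (Space n))] ψ ∧
    ∀ i, (grad v i : Space n → ℝ) =ᵐ[volume.restrict (Ω : Set (Space n))] partialDeriv i ψ

theorem exists_isJetOf (ψ : 𝓓(Ω, ℝ)) : ∃ v : H10 Ω, IsJetOf v ψ := by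
  have h1 : MemLp (ψ : Space n → ℝ) 2 (volume.restrict (Ω : Set (Space n))) :=
    ψ.continuous.memLp_of_hasCompactSupport ψ.hasCompactSupport
  have h2 : ∀ i, MemLp (partialDeriv i ψ) 2 (volume.restrict (Ω : Set (Space n))) := fun i =>
    (continuous_partialDeriv i ψ).memLp_of_hasCompactSupport (hasCompactSupport_partialDeriv i ψ)
  let U : Jet1 Ω := WithLp.toLp 2 (h1.toLp _, WithLp.toLp 2 fun i => (h2 i).toLp _)
  have hU : U ∈ testJets Ω := ⟨ψ, h1.coeFn_toLp, fun i => (h2 i).coeFn_toLp⟩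
  exact ⟨⟨U, Submodule.le_topologicalClosure _ (Submodule.subset_span hU)⟩,
    h1.coeFn_toLp, fun i => (h2 i).coeFn_toLp⟩

theorem partialDeriv_add (i : Fin n) (ψ χ : 𝓓(Ω, ℝ)) (x : Space n) :
    partialDeriv i (ψ + χ : 𝓓(Ω, ℝ)) x = partialDeriv i ψ x + partialDeriv i χ x := by
  have h : ((ψ + χ : 𝓓(Ω, ℝ)) : Space n → ℝ) = fun x => ψ x + χ x := by ext; simp
  unfold partialDeriv
  rw [h, fderiv_fun_add (ψ.contDiff.differentiable (by simp) x)
    (χ.contDiff.differentiable (by simp) x)]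
  simp

theorem partialDeriv_smul (i : Fin n) (c : ℝ) (ψ : 𝓓(Ω, ℝ)) (x : Space n) :
    partialDeriv i (c • ψ : 𝓓(Ω, ℝ)) x = c * partialDeriv i ψ x := by
  have h : ((c • ψ : 𝓓(Ω, ℝ)) : Space n → ℝ) = fun x => c • ψ x := by ext; simp
  unfold partialDeriv
  rw [h, fderiv_fun_const_smul (ψ.contDiff.differentiable (by simp) x)]
  simp

/-- Jets depend linearly on the test function. Hence density needs a single test function rather
than a linear combination of jets. -/
theorem span_testJets (Ω : Opens (Space n)) :
    (Submodule.span ℝ (testJets Ω) : Set (Jet1 Ω)) = testJets Ω := by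
  refine Set.Subset.antisymm (fun U hU => ?_) Submodule.subset_span
  induction hU using Submodule.span_induction with
  | mem U hU => exact hU
  | zero =>
    refine ⟨0, ?_, fun i => ?_⟩
    · filter_upwards [Lp.coeFn_zero ℝ 2 (volume.restrict (Ω : Set (Space n)))] with x hx
      simpa using hx
    · filter_upwards [Lp.coeFn_zero ℝ 2 (volume.restrict (Ω : Set (Space n)))] with x hx
      have := partialDeriv_smul i 0 (0 : 𝓓(Ω, ℝ)) x
      rw [zero_smul, zero_mul] at this
      rw [this]
      exact hx
  | add U V _ _ hU hV =>
    obtain ⟨ψ, h1, h2⟩ := hU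
    obtain ⟨χ, h3, h4⟩ := hV
    refine ⟨ψ + χ, ?_, fun i => ?_⟩
    · filter_upwards [Lp.coeFn_add U.fst V.fst, h1, h3] with x e1 e2 e3
      change (U.fst + V.fst : L2 Ω) x = _
      rw [e1, Pi.add_apply, e2, e3]; simp
    · filter_upwards [Lp.coeFn_add (U.snd i) (V.snd i), h2 i, h4 i] with x e1 e2 e3
      change (U.snd i + V.snd i : L2 Ω) x = _
      rw [e1, Pi.add_apply, e2, e3, partialDeriv_add]
  | smul c U _ hU =>
    obtain ⟨ψ, h1, h2⟩ := hU
    refine ⟨c • ψ, ?_, fun i => ?_⟩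
    · filter_upwards [Lp.coeFn_smul c U.fst, h1] with x e1 e2
      change (c • U.fst : L2 Ω) x = _
      rw [e1, Pi.smul_apply, e2]; simp
    · filter_upwards [Lp.coeFn_smul c (U.snd i), h2 i] with x e1 e2
      change (c • U.snd i : L2 Ω) x = _
      rw [e1, Pi.smul_apply, e2, partialDeriv_smul, smul_eq_mul]

/-- Test functions are dense in `H₀¹(Ω)`. -/
theorem exists_test_near (u : H10 Ω) {ε : ℝ} (hε : 0 < ε) :
    ∃ (ψ : 𝓓(Ω, ℝ)) (v : H10 Ω), IsJetOf v ψ ∧ ‖v - u‖ < ε := by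
  have hu : (u : Jet1 Ω) ∈ closure (testJets Ω) := by
    have := u.2
    rwa [← SetLike.mem_coe, show (H10 Ω : Set (Jet1 Ω)) = _ from
      Submodule.topologicalClosure_coe _, span_testJets] at this
  obtain ⟨U, hU, hd⟩ := Metric.mem_closure_iff.1 hu ε hε
  have hU' : U ∈ H10 Ω := Submodule.le_topologicalClosure _ (Submodule.subset_span hU)
  obtain ⟨ψ, hψ⟩ := hU
  refine ⟨ψ, ⟨U, hU'⟩, hψ, ?_⟩
  rw [dist_comm, dist_eq_norm] at hd
  exact hd

/-! ### Monotone operator equations -/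

/-- Zarantonello's theorem: a coercive bilinear form perturbed by a monotone Lipschitz map defines
a surjective operator. -/
theorem exists_monotone_solution {H : Type*} [NormedAddCommGroup H] [InnerProductSpace ℝ H]
    [CompleteSpace H] (A : H →L[ℝ] H →L[ℝ] ℝ) {m : ℝ} (hm : 0 < m)
    (hA : ∀ u, m * ‖u‖ ^ 2 ≤ A u u) (N : H → StrongDual ℝ H) {L : ℝ}
    (hL : ∀ u v, ‖N u - N v‖ ≤ L * ‖u - v‖) (hN : ∀ u v, 0 ≤ (N u - N v) (u - v))
    (ℓ : StrongDual ℝ H) : ∃ y, ∀ v, A y v + N y v = ℓ v := by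
  set R := (InnerProductSpace.toDual ℝ H).symm with hR
  let G : H → H := fun y => R (A y + N y - ℓ)
  -- A Lipschitz constant for `G`; the summand `m` ensures `M > 0` and `m ≤ M`, so that `q ≥ 0`
  -- below.
  set M : ℝ := ‖A‖ + |L| + m with hM
  have hMpos : 0 < M := by positivity
  have hsub : ∀ u v, G u - G v = R (A (u - v) + (N u - N v)) := by
    intro u v
    simp only [G, ← map_sub]
    congr 1
    rw [map_sub]; abel
  have hG1 : ∀ u v, m * ‖u - v‖ ^ 2 ≤ inner ℝ (G u - G v) (u - v) := by
    intro u v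
    rw [hsub, hR, InnerProductSpace.toDual_symm_apply, add_apply]
    linarith [hA (u - v), hN u v]
  have hG2 : ∀ u v, ‖G u - G v‖ ≤ M * ‖u - v‖ := by
    intro u v
    rw [hsub, LinearIsometryEquiv.norm_map]
    calc ‖A (u - v) + (N u - N v)‖ ≤ ‖A (u - v)‖ + ‖N u - N v‖ := norm_add_le _ _
      _ ≤ ‖A‖ * ‖u - v‖ + |L| * ‖u - v‖ := by
          gcongr
          · exact A.le_opNorm _
          · exact (hL u v).trans (by gcongr; exact le_abs_self _)
      _ ≤ M * ‖u - v‖ := by rw [← add_mul]; gcongr; linarith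
  -- The map `y ↦ y - t G y` has squared Lipschitz constant at most `1 - 2tm + t²M²`; this `t` is
  -- the minimizer and `q` the minimum.
  set t : ℝ := m / M ^ 2 with ht
  set q : ℝ := 1 - m ^ 2 / M ^ 2 with hq
  have hmM : m ≤ M := by rw [hM]; linarith [norm_nonneg A, abs_nonneg L]
  have hq0 : 0 ≤ q := by
    rw [hq, sub_nonneg, div_le_one (by positivity)]
    gcongr
  have hq1 : q < 1 := by rw [hq]; linarith [show 0 < m ^ 2 / M ^ 2 by positivity]
  have hcon : ContractingWith ⟨√q, Real.sqrt_nonneg q⟩ (fun y => y - t • G y) := by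
    refine ⟨?_, LipschitzWith.of_dist_le_mul fun u v => ?_⟩
    · exact NNReal.coe_lt_coe.1 ((Real.sqrt_lt' one_pos).2 (by simpa using hq1))
    · rw [dist_eq_norm, dist_eq_norm]
      change _ ≤ √q * _
      refine (sq_le_sq₀ (norm_nonneg _) (by positivity)).1 ?_
      have e : (u - t • G u) - (v - t • G v) = (u - v) - t • (G u - G v) := by
        rw [smul_sub]; abel
      rw [e, norm_sub_sq_real, mul_pow, Real.sq_sqrt hq0, norm_smul, inner_smul_right,
        real_inner_comm, mul_pow, Real.norm_eq_abs, sq_abs]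
      have h1 := hG1 u v
      have h2 : ‖G u - G v‖ ^ 2 ≤ M ^ 2 * ‖u - v‖ ^ 2 := by
        rw [← mul_pow]; exact pow_le_pow_left₀ (norm_nonneg _) (hG2 u v) 2
      have ht0 : 0 ≤ t := by positivity
      have h3 := mul_le_mul_of_nonneg_left h1 ht0
      have h4 := mul_le_mul_of_nonneg_left h2 (sq_nonneg t)
      have e1 : t * (m * ‖u - v‖ ^ 2) = m ^ 2 / M ^ 2 * ‖u - v‖ ^ 2 := by rw [ht]; ring
      have e2 : t ^ 2 * (M ^ 2 * ‖u - v‖ ^ 2) = m ^ 2 / M ^ 2 * ‖u - v‖ ^ 2 := by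
        rw [ht]; field_simp
      rw [hq]
      linarith
  refine ⟨hcon.fixedPoint, fun v => ?_⟩
  have hfix : hcon.fixedPoint - t • G hcon.fixedPoint = hcon.fixedPoint :=
    hcon.fixedPoint_isFixedPt
  have hG0 : G hcon.fixedPoint = 0 := by
    rw [sub_eq_self, smul_eq_zero] at hfix
    exact hfix.resolve_left (by positivity)
  have : A hcon.fixedPoint + N hcon.fixedPoint - ℓ = 0 :=
    (LinearIsometryEquiv.map_eq_zero_iff R).1 hG0
  have h2 := congrArg (fun T : StrongDual ℝ H => T v) this
  simp only [sub_apply, add_apply, zero_apply] at h2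
  linarith

/-! ### The penalty `β_δ` and its superposition operator -/

theorem beta_eq (δ r : ℝ) : beta δ r = 1 / δ * beta 1 r := by simp [beta]

theorem beta_zero (δ : ℝ) : beta δ 0 = 0 := by simp [beta]

/-- The slopes of `beta 1` lie in `[0, 1]`. Monotonicity and the `1/δ` Lipschitz bound for every `δ`
follow by scaling. -/
theorem beta_one_sub_bounds {r s : ℝ} (h : s ≤ r) :
    0 ≤ beta 1 r - beta 1 s ∧ beta 1 r - beta 1 s ≤ r - s := by
  unfold beta
  split_ifs <;> constructor <;> nlinarith

theorem lipschitzWith_beta {δ : ℝ} (hδ : 0 < δ) :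
    LipschitzWith (Real.toNNReal (1 / δ)) (beta δ) := by
  refine LipschitzWith.of_dist_le_mul fun r s => ?_
  rw [Real.coe_toNNReal _ (by positivity), Real.dist_eq, Real.dist_eq, beta_eq δ r, beta_eq δ s,
    ← mul_sub, abs_mul, abs_of_pos (one_div_pos.2 hδ)]
  refine mul_le_mul_of_nonneg_left ?_ (by positivity)
  rcases le_total s r with h | h
  · have := beta_one_sub_bounds h
    rw [abs_of_nonneg this.1, abs_of_nonneg (sub_nonneg.2 h)]; exact this.2
  · have := beta_one_sub_bounds h
    rw [abs_sub_comm, abs_sub_comm r, abs_of_nonneg this.1, abs_of_nonneg (sub_nonneg.2 h)]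
    exact this.2

theorem monotone_beta {δ : ℝ} (hδ : 0 < δ) : Monotone (beta δ) := by
  intro s r h
  rw [beta_eq δ r, beta_eq δ s]
  have := (beta_one_sub_bounds h).1
  gcongr
  linarith

theorem beta_nonpos {δ : ℝ} (hδ : 0 < δ) (r : ℝ) : beta δ r ≤ 0 := by
  rw [beta_eq]
  refine mul_nonpos_of_nonneg_of_nonpos (by positivity) ?_
  unfold beta
  split_ifs <;> nlinarith

theorem beta_of_nonneg (δ : ℝ) {r : ℝ} (hr : 0 ≤ r) : beta δ r = 0 := by simp [beta, hr]

theorem beta_mul_self_nonneg {δ : ℝ} (hδ : 0 < δ) (r : ℝ) : 0 ≤ beta δ r * r := by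
  rcases le_total 0 r with h | h
  · rw [beta_of_nonneg δ h, zero_mul]
  · exact mul_nonneg_of_nonpos_of_nonpos (beta_nonpos hδ r) h

/-- For `r < 0` the product is `-r³` or `r² + r/4`, strictly positive in its range. This strictness
recovers the constraint `y ≥ φ` in the limit. -/
theorem nonneg_of_beta_one_mul_self_eq_zero {r : ℝ} (h : beta 1 r * r = 0) : 0 ≤ r := by
  by_contra! hr
  unfold beta at h
  rw [if_neg hr.not_ge] at h
  split_ifs at h
  · have : r ^ 3 = 0 := by linear_combination -h
    exact hr.ne (pow_eq_zero_iff (by norm_num) |>.1 this)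
  · nlinarith

theorem betaDeriv_nonneg {δ : ℝ} (hδ : 0 < δ) (r : ℝ) : 0 ≤ betaDeriv δ r := by
  unfold betaDeriv
  refine mul_nonneg (by positivity) ?_
  split_ifs <;> linarith

theorem betaDeriv_le {δ : ℝ} (hδ : 0 < δ) (r : ℝ) : betaDeriv δ r ≤ 1 / δ := by
  unfold betaDeriv
  refine mul_le_of_le_one_right (by positivity) ?_
  split_ifs <;> linarith

theorem measurable_betaDeriv (δ : ℝ) : Measurable (betaDeriv δ) := by
  unfold betaDeriv
  refine Measurable.const_mul (Measurable.ite measurableSet_Ici measurable_const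
    (Measurable.ite measurableSet_Ici ?_ measurable_const)) _
  fun_prop

/-- The superposition operator `u ↦ β_δ ∘ u` on `L²(Ω)`. -/
def betaLp {δ : ℝ} (hδ : 0 < δ) (u : L2 Ω) : L2 Ω :=
  (lipschitzWith_beta hδ).compLp (beta_zero δ) u

theorem coeFn_betaLp {δ : ℝ} (hδ : 0 < δ) (u : L2 Ω) :
    (betaLp hδ u : Space n → ℝ) =ᵐ[volume.restrict (Ω : Set (Space n))]
      fun x => beta δ (u x) :=
  LipschitzWith.coeFn_compLp _ _ _

theorem norm_betaLp_sub_le {δ : ℝ} (hδ : 0 < δ) (u v : L2 Ω) :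
    ‖betaLp hδ u - betaLp hδ v‖ ≤ 1 / δ * ‖u - v‖ := by
  have := LipschitzWith.norm_compLp_sub_le (lipschitzWith_beta hδ) (beta_zero δ) u v
  rwa [Real.coe_toNNReal _ (by positivity)] at this

theorem integral_beta_mul {δ : ℝ} (hδ : 0 < δ) (u w v : L2 Ω) :
    ∫ x in (Ω : Set (Space n)), beta δ (u x - w x) * v x = inner ℝ (betaLp hδ (u - w)) v := by
  rw [← integral_mul_eq_inner]
  refine integral_congr_ae ?_
  filter_upwards [coeFn_betaLp hδ (u - w), Lp.coeFn_sub u w] with x h1 h2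
  rw [h1, h2, Pi.sub_apply]

theorem inner_nonneg_of_ae {u v : L2 Ω}
    (h : ∀ᵐ x ∂(volume.restrict (Ω : Set (Space n))), 0 ≤ u x * v x) : 0 ≤ inner ℝ u v := by
  rw [← integral_mul_eq_inner]
  exact integral_nonneg_of_ae h

theorem inner_betaLp_sub_nonneg {δ : ℝ} (hδ : 0 < δ) (u v : L2 Ω) :
    0 ≤ inner ℝ (betaLp hδ u - betaLp hδ v) (u - v) := by
  refine inner_nonneg_of_ae ?_
  filter_upwards [coeFn_betaLp hδ u, coeFn_betaLp hδ v, Lp.coeFn_sub u v,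
    Lp.coeFn_sub (betaLp hδ u) (betaLp hδ v)] with x h1 h2 h3 h4
  rw [h3, h4, Pi.sub_apply, Pi.sub_apply, h1, h2]
  rcases le_total (u x) (v x) with h | h
  · exact mul_nonneg_of_nonpos_of_nonpos (sub_nonpos.2 (monotone_beta hδ h)) (sub_nonpos.2 h)
  · exact mul_nonneg (sub_nonneg.2 (monotone_beta hδ h)) (sub_nonneg.2 h)

/-! ### Penalized states: existence and uniform bounds -/

theorem isPenalizedState_iff {K : Coeffs n} {f : L2 Ω} {δ : ℝ} (hδ : 0 < δ) {φ y : H10 Ω} :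
    IsPenalizedState K f δ φ y ↔
      ∀ v, form K y v + inner ℝ (betaLp hδ (fn y - fn φ)) (fn v) = inner ℝ f (fn v) := by
  unfold IsPenalizedState
  simp_rw [integral_beta_mul hδ]

/-- Zarantonello's theorem applies because `y ↦ β_δ(y - φ)` is monotone and `1/δ`-Lipschitz from
`H₀¹` to its dual. -/
theorem exists_isPenalizedState {K : Coeffs n} (hK : K.Admissible Ω) (f : L2 Ω) {δ : ℝ}
    (hδ : 0 < δ) (φ : H10 Ω) : ∃ y, IsPenalizedState K f δ φ y := by
  obtain ⟨A, hA⟩ := exists_form_bilin hK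
  obtain ⟨m, hm, hcoer⟩ := hK.coercive
  have hN : ∀ u v : H10 Ω, ((innerSL ℝ (betaLp hδ (fn u - fn φ))).comp (fnL Ω)
      - (innerSL ℝ (betaLp hδ (fn v - fn φ))).comp (fnL Ω))
      = (innerSL ℝ (betaLp hδ (fn u - fn φ) - betaLp hδ (fn v - fn φ))).comp (fnL Ω) := by
    intro u v
    ext w
    simp
  have hfs : ∀ u v : H10 Ω, fn u - fn φ - (fn v - fn φ) = fn (u - v) := by
    intro u v
    rw [fn_sub]; abel
  obtain ⟨y, hy⟩ := exists_monotone_solution A hm (fun u => by rw [hA]; exact hcoer u)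
    (fun y => (innerSL ℝ (betaLp hδ (fn y - fn φ))).comp (fnL Ω)) (L := 1 / δ)
    (fun u v => by
      rw [hN]
      refine ContinuousLinearMap.opNorm_le_bound _ (by positivity) fun w => ?_
      rw [ContinuousLinearMap.comp_apply, innerSL_apply_apply, fnL_apply]
      refine (norm_inner_le_norm _ _).trans ?_
      refine mul_le_mul ((norm_betaLp_sub_le hδ _ _).trans ?_) (norm_fn_le w) (norm_nonneg _)
        (by positivity)
      rw [hfs]
      gcongr
      exact norm_fn_le _)
    (fun u v => by
      rw [hN, ContinuousLinearMap.comp_apply, innerSL_apply_apply, fnL_apply, ← hfs]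
      exact inner_betaLp_sub_nonneg hδ _ _)
    ((innerSL ℝ f).comp (fnL Ω))
  refine ⟨y, (isPenalizedState_iff hδ).2 fun v => ?_⟩
  have := hy v
  rwa [hA] at this

/-- Penalized states satisfy the variational inequality for all competitors above the obstacle. -/
theorem IsPenalizedState.le_form {K : Coeffs n} {f : L2 Ω} {δ : ℝ} (hδ : 0 < δ) {φ y w : H10 Ω}
    (hy : IsPenalizedState K f δ φ y) (hw : w ∈ obstacleSet φ) :
    inner ℝ f (fn (w - y)) ≤ form K y (w - y) := by
  have h := (isPenalizedState_iff hδ).1 hy (w - y)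
  -- Where `y ≥ φ` the penalty vanishes; elsewhere it is nonpositive and `y ≤ φ ≤ w`.
  have : 0 ≤ inner ℝ (betaLp hδ (fn y - fn φ)) (fn (y - w)) := by
    refine inner_nonneg_of_ae ?_
    filter_upwards [coeFn_betaLp hδ (fn y - fn φ), Lp.coeFn_sub (fn y) (fn φ),
      Lp.coeFn_sub (fn y) (fn w), hw] with x h1 h2 h3 h4
    rw [h1, fn_sub, h3, h2, Pi.sub_apply, Pi.sub_apply]
    rcases le_total 0 (fn y x - fn φ x) with h | h
    · rw [beta_of_nonneg δ h, zero_mul]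
    · exact mul_nonneg_of_nonpos_of_nonpos (beta_nonpos hδ _) (by linarith)
  have e : fn (y - w) = -fn (w - y) := by rw [fn_sub, fn_sub]; abel
  rw [e, inner_neg_right] at this
  linarith

theorem exists_bilin_bound {H : Type*} [SeminormedAddCommGroup H] [NormedSpace ℝ H]
    (A : H →L[ℝ] H →L[ℝ] ℝ) : ∃ M, 0 ≤ M ∧ ∀ u v, |A u v| ≤ M * ‖u‖ * ‖v‖ :=
  ⟨‖A‖, A.opNorm_nonneg, A.le_opNorm₂⟩

theorem exists_form_bound {K : Coeffs n} (hK : K.Admissible Ω) :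
    ∃ M, 0 ≤ M ∧ ∀ u v : H10 Ω, |form K u v| ≤ M * ‖u‖ * ‖v‖ := by
  obtain ⟨A, hA⟩ := exists_form_bilin hK
  obtain ⟨M, hM, h⟩ := exists_bilin_bound A
  exact ⟨M, hM, fun u v => by rw [← hA]; exact h u v⟩

theorem mem_obstacleSet_self (φ : H10 Ω) : φ ∈ obstacleSet φ :=
  EventuallyLE.refl (ae (volume.restrict (Ω : Set (Space n)))) (fn φ : Space n → ℝ)

/-- A bound for penalized states that is uniform in the penalization parameter. -/
theorem exists_norm_penalizedState_le {K : Coeffs n} (hK : K.Admissible Ω) (f : L2 Ω) (R : ℝ) :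
    ∃ C, ∀ δ > 0, ∀ φ y : H10 Ω, ‖φ‖ ≤ R → IsPenalizedState K f δ φ y → ‖y‖ ≤ C := by
  obtain ⟨A, hA⟩ := exists_form_bilin hK
  obtain ⟨M, hM, hbd⟩ := exists_form_bound hK
  obtain ⟨m, hm, hcoer⟩ := hK.coercive
  -- The competitor `φ` yields `m t² ≤ a t + b` for `t = ‖y‖`, `a = MR + ‖f‖`, `b = ‖f‖R`. If `t ≥
  -- 1` then `t ≤ (a + b)/m`; the summand 1 covers `t < 1`.
  refine ⟨(M * R + ‖f‖) / m + 1 + ‖f‖ * R / m, fun δ hδ φ y hφ hy => ?_⟩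
  have h := hy.le_form hδ (mem_obstacleSet_self φ)
  rw [← hA, map_sub, hA y y, hA y φ] at h
  have h1 := hcoer y
  have h2 : form K y φ ≤ M * ‖y‖ * R := (le_abs_self _).trans <|
    (hbd y φ).trans (by gcongr)
  have h3 : -(‖f‖ * (R + ‖y‖)) ≤ inner ℝ f (fn (φ - y)) := by
    refine neg_le_of_abs_le ((abs_real_inner_le_norm _ _).trans ?_)
    gcongr
    refine (norm_fn_le _).trans ((norm_sub_le _ _).trans ?_)
    gcongr
  have hR : 0 ≤ R := (norm_nonneg _).trans hφ
  set a := M * R + ‖f‖ with ha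
  have ha0 : 0 ≤ a := by positivity
  set b := ‖f‖ * R with hb
  have hb0 : 0 ≤ b := by positivity
  have key : m * ‖y‖ ^ 2 ≤ a * ‖y‖ + b := by rw [ha, hb]; linarith
  by_contra! hc
  have hy1 : 1 ≤ ‖y‖ := by
    have : 0 ≤ a / m := by positivity
    have : 0 ≤ b / m := by positivity
    linarith
  have : ‖y‖ ≤ a / m + b / m := by
    rw [← add_div, le_div_iff₀ hm]
    by_contra! hh
    nlinarith
  linarith

/-! ### Rellich's theorem by Fourier transform -/

-- The Fourier transform turns `∂ᵢ` into multiplication by `2πi ξᵢ`.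
open scoped FourierTransform SchwartzMap LineDeriv in
theorem norm_fourier_lineDeriv (S : 𝓢(Space n, ℂ)) (i : Fin n) (ξ : Space n) :
    ‖𝓕 (∂_{(EuclideanSpace.single i 1 : Space n)} S) ξ‖ ^ 2
      = (2 * Real.pi) ^ 2 * (ξ i ^ 2 * ‖𝓕 S ξ‖ ^ 2) := by
  have : (fun x : Space n => inner ℝ x (EuclideanSpace.single i (1 : ℝ))).HasTemperateGrowth :=
    ((innerSL ℝ).flip (EuclideanSpace.single i (1 : ℝ) : Space n)).hasTemperateGrowth
  rw [SchwartzMap.fourier_lineDerivOp_eq, _root_.smul_apply,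
    SchwartzMap.smulLeftCLM_apply_apply this, EuclideanSpace.inner_single_right, norm_smul,
    norm_smul]
  simp only [Complex.norm_mul, Complex.norm_I, Complex.norm_real, Real.norm_eq_abs,
    Complex.norm_ofNat, mul_one, one_mul, conj_trivial, mul_pow, sq_abs]

open scoped FourierTransform SchwartzMap in
theorem integrable_norm_sq_schwartz (S : 𝓢(Space n, ℂ)) :
    Integrable (fun x => ‖S x‖ ^ 2) volume :=
  (S.memLp 2 volume).integrable_norm_pow (by norm_num)

open scoped FourierTransform SchwartzMap LineDeriv in
/-- Schwartz functions with bounded gradients whose Fourier transforms are bounded and tend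
to zero pointwise tend to zero in `L²`. -/
theorem tendsto_integral_norm_sq_of_fourier (S : ℕ → 𝓢(Space n, ℂ)) {C D : ℝ}
    (hpt : ∀ ξ, Tendsto (fun k => 𝓕 (S k) ξ) atTop (𝓝 0))
    (hD : ∀ k ξ, ‖𝓕 (S k) ξ‖ ≤ D)
    (hC : ∀ k, ∑ i, ∫ x, ‖(∂_{(EuclideanSpace.single i 1 : Space n)} (S k)) x‖ ^ 2 ≤ C) :
    Tendsto (fun k => ∫ x, ‖S k x‖ ^ 2) atTop (𝓝 0) := by
  -- Low frequencies: dominated convergence on a ball, with the constant majorant `D²`.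
  have hlow : ∀ R : ℝ, Tendsto (fun k => ∫ ξ in Metric.ball (0 : Space n) R, ‖𝓕 (S k) ξ‖ ^ 2)
      atTop (𝓝 0) := by
    intro R
    have := tendsto_integral_of_dominated_convergence (μ := volume.restrict (Metric.ball 0 R))
      (F := fun k ξ => ‖𝓕 (S k) ξ‖ ^ 2) (f := fun _ => (0 : ℝ)) (fun _ => D ^ 2)
      (fun k => ((integrable_norm_sq_schwartz (𝓕 (S k))).aestronglyMeasurable).restrict)
      (integrableOn_const (by exact measure_ball_lt_top.ne))
      (fun k => Eventually.of_forall fun ξ => by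
        rw [Real.norm_eq_abs, abs_of_nonneg (sq_nonneg _)]
        exact pow_le_pow_left₀ (norm_nonneg _) (hD k ξ) 2)
      (Eventually.of_forall fun ξ => by
        have := ((hpt ξ).norm.pow 2)
        simpa using this)
    simpa using this
  have hint : ∀ k i, Integrable (fun ξ : Space n => ξ i ^ 2 * ‖𝓕 (S k) ξ‖ ^ 2) volume := by
    intro k i
    have h := integrable_norm_sq_schwartz (𝓕 (∂_{(EuclideanSpace.single i 1 : Space n)} (S k)))
    simp_rw [norm_fourier_lineDeriv] at h
    have h2 := h.const_mul (((2 * Real.pi) ^ 2)⁻¹)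
    refine h2.congr (Eventually.of_forall fun ξ => ?_)
    have : (2 * Real.pi) ^ 2 ≠ 0 := by positivity
    field_simp
  have hmom : ∀ k, ∑ i, ∫ ξ : Space n, ξ i ^ 2 * ‖𝓕 (S k) ξ‖ ^ 2 ≤ C := by
    intro k
    refine (Finset.sum_le_sum fun i _ => ?_).trans (hC k)
    rw [← SchwartzMap.integral_norm_sq_fourier]
    simp_rw [norm_fourier_lineDeriv]
    rw [integral_const_mul]
    refine le_mul_of_one_le_left (integral_nonneg fun ξ => by positivity) ?_
    nlinarith [Real.pi_gt_three]
  have hC0 : 0 ≤ C := (Finset.sum_nonneg fun i _ => integral_nonneg fun x => by positivity).trans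
    (hC 0)
  -- High frequencies: outside the ball `1 ≤ |ξ|²/R²`, and the second moment of the transform is
  -- controlled by the gradient.
  have hhigh : ∀ k, ∀ R > 0,
      ∫ ξ in (Metric.ball (0 : Space n) R)ᶜ, ‖𝓕 (S k) ξ‖ ^ 2 ≤ C / R ^ 2 := by
    intro k R hR
    have hI : Integrable (fun ξ : Space n => ∑ i, ξ i ^ 2 * ‖𝓕 (S k) ξ‖ ^ 2) volume :=
      integrable_finsetSum _ fun i _ => hint k i
    calc ∫ ξ in (Metric.ball (0 : Space n) R)ᶜ, ‖𝓕 (S k) ξ‖ ^ 2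
        ≤ ∫ ξ in (Metric.ball (0 : Space n) R)ᶜ, (∑ i, ξ i ^ 2 * ‖𝓕 (S k) ξ‖ ^ 2) / R ^ 2 := by
          refine setIntegral_mono_on (integrable_norm_sq_schwartz (𝓕 (S k))).integrableOn
            (hI.div_const _).integrableOn Metric.isOpen_ball.measurableSet.compl fun ξ hξ => ?_
          rw [← Finset.sum_mul, le_div_iff₀ (by positivity), mul_comm]
          refine mul_le_mul_of_nonneg_right ?_ (sq_nonneg _)
          rw [← EuclideanSpace.real_norm_sq_eq]
          have : R ≤ ‖ξ‖ := by simpa using hξ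
          gcongr
      _ ≤ ∫ ξ : Space n, (∑ i, ξ i ^ 2 * ‖𝓕 (S k) ξ‖ ^ 2) / R ^ 2 :=
          setIntegral_le_integral (hI.div_const _)
            (Eventually.of_forall fun ξ => by positivity)
      _ = (∑ i, ∫ ξ : Space n, ξ i ^ 2 * ‖𝓕 (S k) ξ‖ ^ 2) / R ^ 2 := by
          rw [integral_div, integral_finsetSum _ fun i _ => hint k i]
      _ ≤ C / R ^ 2 := by gcongr; exact hmom k
  rw [Metric.tendsto_atTop]
  intro ε hε
  obtain ⟨R, hR, hRε⟩ : ∃ R : ℝ, 0 < R ∧ C / R ^ 2 < ε / 2 := by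
    -- The summand 1 gives `R > 0` and `R² > 2C/ε` strictly.
    refine ⟨√(2 * C / ε) + 1, by positivity, ?_⟩
    rw [div_lt_iff₀ (by positivity)]
    have h1 : √(2 * C / ε) ^ 2 = 2 * C / ε := Real.sq_sqrt (by positivity)
    have h2 : ε / 2 * (2 * C / ε) = C := by field_simp
    nlinarith [Real.sqrt_nonneg (2 * C / ε), mul_pos hε (show (0:ℝ) < 1 by norm_num),
      mul_nonneg hε.le (Real.sqrt_nonneg (2 * C / ε))]
  obtain ⟨N, hN⟩ := Metric.tendsto_atTop.1 (hlow R) (ε / 2) (by positivity)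
  refine ⟨N, fun k hk => ?_⟩
  have h1 := hN k hk
  rw [Real.dist_0_eq_abs] at h1 ⊢
  have h2 := (abs_lt.1 h1).2
  rw [abs_of_nonneg (integral_nonneg fun x => by positivity),
    ← SchwartzMap.integral_norm_sq_fourier,
    ← integral_add_compl Metric.isOpen_ball.measurableSet (s := Metric.ball 0 R)
      (integrable_norm_sq_schwartz (𝓕 (S k)))]
  linarith [hhigh k R hR]

/-- A test function as a complex-valued Schwartz function. -/
def toSchwartz (ψ : 𝓓(Ω, ℝ)) : SchwartzMap (Space n) ℂ :=
  HasCompactSupport.toSchwartzMap (f := fun x => (ψ x : ℂ))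
    (ψ.hasCompactSupport.comp_left (g := Complex.ofReal) Complex.ofReal_zero)
    (Complex.ofRealCLM.contDiff.comp ψ.contDiff)

theorem toSchwartz_apply (ψ : 𝓓(Ω, ℝ)) (x : Space n) : toSchwartz ψ x = (ψ x : ℂ) := rfl

open scoped LineDeriv in
theorem lineDeriv_toSchwartz (ψ : 𝓓(Ω, ℝ)) (i : Fin n) (x : Space n) :
    (∂_{(EuclideanSpace.single i 1 : Space n)} (toSchwartz ψ)) x = (partialDeriv i ψ x : ℂ) := by
  rw [SchwartzMap.lineDerivOp_apply_eq_fderiv]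
  have h : (toSchwartz ψ : Space n → ℂ) = Complex.ofRealCLM ∘ ψ := rfl
  have hd : DifferentiableAt ℝ (ψ : Space n → ℝ) x := ψ.contDiff.differentiable (by simp) x
  rw [h, (Complex.ofRealCLM.hasFDerivAt.comp x hd.hasFDerivAt).fderiv]
  simp [partialDeriv]

theorem test_eq_zero (ψ : 𝓓(Ω, ℝ)) {x : Space n} (hx : x ∉ (Ω : Set (Space n))) : ψ x = 0 :=
  image_eq_zero_of_notMem_tsupport fun h => hx (ψ.tsupport_subset h)

theorem partialDeriv_test_eq_zero (ψ : 𝓓(Ω, ℝ)) (i : Fin n) {x : Space n}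
    (hx : x ∉ (Ω : Set (Space n))) : partialDeriv i ψ x = 0 := by
  have : x ∉ tsupport (fderiv ℝ ψ) := fun h => hx (ψ.tsupport_subset (tsupport_fderiv_subset ℝ h))
  rw [partialDeriv, image_eq_zero_of_notMem_tsupport this]
  simp

theorem integral_norm_sq_eq {g : Space n → ℂ} {h : Space n → ℝ} (hg : ∀ x, g x = (h x : ℂ))
    (h0 : ∀ x ∉ (Ω : Set (Space n)), h x = 0) {u : L2 Ω}
    (hu : (u : Space n → ℝ) =ᵐ[volume.restrict (Ω : Set (Space n))] h) :
    ∫ x, ‖g x‖ ^ 2 = ‖u‖ ^ 2 := by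
  rw [← real_inner_self_eq_norm_sq, ← integral_mul_eq_inner,
    ← setIntegral_eq_integral_of_forall_compl_eq_zero (s := (Ω : Set (Space n)))]
  · refine integral_congr_ae ?_
    filter_upwards [hu] with x hx
    rw [hg, hx, Complex.norm_real, Real.norm_eq_abs, sq_abs, sq]
  · intro x hx
    rw [hg, h0 x hx]; simp

theorem memLp_of_bounded_continuous (hΩ : Bornology.IsBounded (Ω : Set (Space n)))
    {g : Space n → ℝ} (hg : Continuous g) {C : ℝ} (hC : ∀ x, |g x| ≤ C) :
    MemLp g 2 (volume.restrict (Ω : Set (Space n))) := by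
  have : IsFiniteMeasure (volume.restrict (Ω : Set (Space n))) :=
    isFiniteMeasure_restrict.2 hΩ.measure_lt_top.ne
  exact MemLp.of_bound hg.aestronglyMeasurable C (Eventually.of_forall hC)

-- Since `Ω` is bounded, `cos` and `sin` of `-2π⟨x, ξ⟩` lie in `L²(Ω)`, with a norm bound
-- independent of `ξ`. The transform at a fixed `ξ` is thus weakly continuous in `u`, which supplies
-- both the pointwise convergence and the uniform bound of the frequency argument.
open scoped FourierTransform in
theorem fourier_toSchwartz (hΩ : Bornology.IsBounded (Ω : Set (Space n))) (ξ : Space n) :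
    ∃ c s : L2 Ω, ‖c‖ ^ 2 ≤ volume.real (Ω : Set (Space n)) ∧
      ‖s‖ ^ 2 ≤ volume.real (Ω : Set (Space n)) ∧
      ∀ (ψ : 𝓓(Ω, ℝ)) (u : L2 Ω),
        (u : Space n → ℝ) =ᵐ[volume.restrict (Ω : Set (Space n))] ψ →
        𝓕 (toSchwartz ψ) ξ = (inner ℝ c u : ℝ) + (inner ℝ s u : ℝ) * Complex.I := by
  have : IsFiniteMeasure (volume.restrict (Ω : Set (Space n))) :=
    isFiniteMeasure_restrict.2 hΩ.measure_lt_top.ne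
  have hcc : Continuous fun x : Space n => Real.cos (-2 * Real.pi * inner ℝ x ξ) := by fun_prop
  have hsc : Continuous fun x : Space n => Real.sin (-2 * Real.pi * inner ℝ x ξ) := by fun_prop
  have hc := memLp_of_bounded_continuous hΩ hcc fun x => Real.abs_cos_le_one _
  have hs := memLp_of_bounded_continuous hΩ hsc fun x => Real.abs_sin_le_one _
  have hbd : ∀ (g : Space n → ℝ) (hg : MemLp g 2 (volume.restrict (Ω : Set (Space n)))),
      (∀ x, |g x| ≤ 1) → ‖hg.toLp g‖ ^ 2 ≤ volume.real (Ω : Set (Space n)) := by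
    intro g hg h1
    rw [← real_inner_self_eq_norm_sq, ← integral_mul_eq_inner]
    calc ∫ x in (Ω : Set (Space n)), hg.toLp g x * hg.toLp g x
        ≤ ∫ x in (Ω : Set (Space n)), (1 : ℝ) := by
          refine integral_mono_ae (integrable_mul _ _) (integrable_const _) ?_
          filter_upwards [hg.coeFn_toLp] with x hx
          rw [hx, ← sq, ← sq_abs]
          exact pow_le_one₀ (abs_nonneg _) (h1 x)
      _ = volume.real (Ω : Set (Space n)) := by simp [Measure.real]
  refine ⟨hc.toLp _, hs.toLp _, hbd _ hc fun x => Real.abs_cos_le_one _,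
    hbd _ hs fun x => Real.abs_sin_le_one _, fun ψ u hu => ?_⟩
  have hint : ∀ g : Space n → ℝ, Continuous g →
      ∀ (hg : MemLp g 2 (volume.restrict (Ω : Set (Space n)))),
      inner ℝ (hg.toLp g) u = ∫ x, g x * ψ x := by
    intro g hgc hg
    rw [← integral_mul_eq_inner,
      ← setIntegral_eq_integral_of_forall_compl_eq_zero (s := (Ω : Set (Space n)))
        (f := fun x => g x * ψ x)]
    · refine integral_congr_ae ?_
      filter_upwards [hu, hg.coeFn_toLp] with x h1 h2
      rw [h1, h2]
    · intro x hx
      rw [test_eq_zero ψ hx, mul_zero]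
  have hI : ∀ g : Space n → ℝ, Continuous g → Integrable (fun x => g x * ψ x) volume :=
    fun g hg => (hg.mul ψ.continuous).integrable_of_hasCompactSupport ψ.hasCompactSupport.mul_left
  rw [hint _ hcc hc, hint _ hsc hs, SchwartzMap.fourier_coe, Real.fourier_eq']
  rw [← integral_complex_ofReal, ← integral_complex_ofReal, ← integral_mul_const,
    ← integral_add (hI _ hcc).ofReal ((hI _ hsc).ofReal.mul_const _)]
  refine integral_congr_ae (Eventually.of_forall fun x => ?_)
  simp only [toSchwartz_apply, smul_eq_mul, Complex.exp_mul_I, ← Complex.ofReal_cos,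
    ← Complex.ofReal_sin]
  push_cast
  ring

open scoped FourierTransform in
theorem tendsto_norm_fn_of_test (hΩ : Bornology.IsBounded (Ω : Set (Space n)))
    (ψ : ℕ → 𝓓(Ω, ℝ)) (v : ℕ → H10 Ω) (hv : ∀ k, IsJetOf (v k) (ψ k)) {C : ℝ}
    (hC : ∀ k, ‖v k‖ ≤ C)
    (hw : ∀ g : L2 Ω, Tendsto (fun k => (inner ℝ g (fn (v k)) : ℝ)) atTop (𝓝 0)) :
    Tendsto (fun k => ‖fn (v k)‖) atTop (𝓝 0) := by
  have h1 : ∀ k, ∫ x, ‖toSchwartz (ψ k) x‖ ^ 2 = ‖fn (v k)‖ ^ 2 := fun k =>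
    integral_norm_sq_eq (toSchwartz_apply (ψ k)) (fun x hx => test_eq_zero _ hx) (hv k).1
  have hC0 : 0 ≤ C := (norm_nonneg _).trans (hC 0)
  have key := tendsto_integral_norm_sq_of_fourier (fun k => toSchwartz (ψ k)) (C := C ^ 2)
    (D := 2 * (√(volume.real (Ω : Set (Space n))) * C)) ?_ ?_ ?_
  · simp_rw [h1] at key
    have := key.sqrt
    simpa [Real.sqrt_sq] using this
  · intro ξ
    obtain ⟨c, s, -, -, h⟩ := fourier_toSchwartz hΩ ξ
    simp_rw [fun k => h (ψ k) _ (hv k).1]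
    have e1 := (Complex.continuous_ofReal.tendsto 0).comp (hw c)
    have e2 := ((Complex.continuous_ofReal.tendsto 0).comp (hw s)).mul_const Complex.I
    simpa using e1.add e2
  · intro k ξ
    obtain ⟨c, s, hc, hs, h⟩ := fourier_toSchwartz hΩ ξ
    have hb : ∀ g : L2 Ω, ‖g‖ ^ 2 ≤ volume.real (Ω : Set (Space n)) →
        |inner ℝ g (fn (v k))| ≤ √(volume.real (Ω : Set (Space n))) * C := fun g hg =>
      (abs_real_inner_le_norm _ _).trans (mul_le_mul (Real.le_sqrt_of_sq_le hg)
        ((norm_fn_le _).trans (hC k)) (norm_nonneg _) (Real.sqrt_nonneg _))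
    rw [h (ψ k) _ (hv k).1]
    refine (norm_add_le _ _).trans ?_
    rw [norm_mul, Complex.norm_I, mul_one, Complex.norm_real, Complex.norm_real, two_mul]
    exact add_le_add (hb c hc) (hb s hs)
  · intro k
    have : ∀ i, ∫ x, ‖(LineDeriv.lineDerivOp (EuclideanSpace.single i 1 : Space n)
        (toSchwartz (ψ k))) x‖ ^ 2 = ‖grad (v k) i‖ ^ 2 := fun i =>
      integral_norm_sq_eq (lineDeriv_toSchwartz (ψ k) i)
        (fun x hx => partialDeriv_test_eq_zero _ i hx) ((hv k).2 i)
    simp_rw [this]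
    have h2 := norm_sq_eq (v k)
    have h3 := pow_le_pow_left₀ (norm_nonneg _) (hC k) 2
    linarith [sq_nonneg ‖fn (v k)‖]

/-- Rellich's theorem: the inclusion of `H₀¹(Ω)` in `L²(Ω)` maps bounded sequences converging
weakly in `L²(Ω)` to strongly convergent ones. -/
theorem tendsto_norm_fn_of_weak (hΩ : Bornology.IsBounded (Ω : Set (Space n)))
    (u : ℕ → H10 Ω) {C : ℝ} (hC : ∀ k, ‖u k‖ ≤ C)
    (hw : ∀ g : L2 Ω, Tendsto (fun k => (inner ℝ g (fn (u k)) : ℝ)) atTop (𝓝 0)) :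
    Tendsto (fun k => ‖fn (u k)‖) atTop (𝓝 0) := by
  -- Test functions within `1/(k+1)` of `u k` have the same weak and strong limits, so the smooth
  -- case suffices.
  choose ψ v hv hd using fun k => exists_test_near (u k) (Nat.one_div_pos_of_nat (α := ℝ) (n := k))
  have hd0 : Tendsto (fun k => ‖fn (v k - u k)‖) atTop (𝓝 0) :=
    squeeze_zero (fun _ => norm_nonneg _) (fun k => (norm_fn_le _).trans (hd k).le)
      tendsto_one_div_add_atTop_nhds_zero_nat
  have hv0 := tendsto_norm_fn_of_test hΩ ψ v hv (C := C + 1)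
    (fun k => by
      have h1 : ‖v k - u k‖ ≤ 1 := (hd k).le.trans (by
        rw [div_le_one (by positivity)]; linarith [Nat.cast_nonneg (α := ℝ) k])
      have h2 := norm_le_insert' (v k) (u k)
      linarith [hC k])
    (fun g => by
      have h1 : Tendsto (fun k => (inner ℝ g (fn (v k - u k)) : ℝ)) atTop (𝓝 0) := by
        refine squeeze_zero_norm (fun k => norm_inner_le_norm _ _) ?_
        simpa using hd0.const_mul ‖g‖
      have h2 := (hw g).add h1
      rw [add_zero] at h2
      refine h2.congr fun k => ?_
      rw [← inner_add_right, ← fn_add, add_sub_cancel])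
  refine squeeze_zero (fun _ => norm_nonneg _) (fun k => ?_) (by simpa using hv0.add hd0)
  have : fn (u k) = fn (v k) - fn (v k - u k) := by rw [fn_sub]; abel
  rw [this]
  exact norm_sub_le _ _

/-! ### Weak convergence and lower semicontinuity -/

/-- Weak convergence of sequences. -/
def WeakTendsto {H : Type*} [NormedAddCommGroup H] [NormedSpace ℝ H] (u : ℕ → H) (u₀ : H) : Prop :=
  ∀ ℓ : StrongDual ℝ H, Tendsto (fun k => ℓ (u k)) atTop (𝓝 (ℓ u₀))

theorem WeakTendsto.comp {H : Type*} [NormedAddCommGroup H] [NormedSpace ℝ H] {u : ℕ → H} {u₀ : H}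
    (h : WeakTendsto u u₀) {σ : ℕ → ℕ} (hσ : StrictMono σ) : WeakTendsto (u ∘ σ) u₀ :=
  fun ℓ => (h ℓ).comp hσ.tendsto_atTop

/-- Bounded sequences in a separable Hilbert space have weakly convergent subsequences. -/
theorem exists_weakTendsto_subseq {H : Type*} [NormedAddCommGroup H] [InnerProductSpace ℝ H]
    [CompleteSpace H] [SeparableSpace H] {u : ℕ → H} {C : ℝ} (hC : ∀ k, ‖u k‖ ≤ C) :
    ∃ (σ : ℕ → ℕ) (u₀ : H), StrictMono σ ∧ WeakTendsto (u ∘ σ) u₀ := by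
  obtain ⟨T, -, σ, hσ, hT⟩ := (WeakDual.isSeqCompact_closedBall ℝ H 0 C)
    (x := fun k => StrongDual.toWeakDual (InnerProductSpace.toDual ℝ H (u k)))
    (fun k => by simpa using hC k)
  refine ⟨σ, (InnerProductSpace.toDual ℝ H).symm (WeakDual.toStrongDual T), hσ, fun ℓ => ?_⟩
  have h := ((WeakDual.eval_continuous ((InnerProductSpace.toDual ℝ H).symm ℓ)).tendsto T).comp hT
  have e : ∀ v : H, ℓ v = inner ℝ v ((InnerProductSpace.toDual ℝ H).symm ℓ) := fun v => by
    rw [real_inner_comm, InnerProductSpace.toDual_symm_apply]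
  rw [e, InnerProductSpace.toDual_symm_apply]
  refine h.congr fun k => ?_
  rw [Function.comp_apply, e]
  rfl

/-- Weak lower semicontinuity of nonnegative quadratic forms. -/
theorem WeakTendsto.le_of_tendsto {H : Type*} [NormedAddCommGroup H] [NormedSpace ℝ H]
    {u : ℕ → H} {u₀ : H} (h : WeakTendsto u u₀) (B : H →L[ℝ] H →L[ℝ] ℝ) (hB : ∀ v, 0 ≤ B v v)
    {c : ℕ → ℝ} {c₀ : ℝ} (hc : Tendsto c atTop (𝓝 c₀)) (hle : ∀ k, B (u k) (u k) ≤ c k) :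
    B u₀ u₀ ≤ c₀ := by
  -- Expanding `0 ≤ B(u_k - u₀, u_k - u₀)` bounds `B(u_k, u_k)` below by terms linear in `u_k`; no
  -- symmetry of `B` is needed.
  have h1 := ((h (B.flip u₀)).add (h (B u₀))).sub_const (B u₀ u₀)
  have := le_of_tendsto_of_tendsto' h1 hc fun k => by
    have h2 := hB (u k - u₀)
    rw [map_sub, map_sub, sub_apply, sub_apply] at h2
    rw [ContinuousLinearMap.flip_apply]
    linarith [hle k]
  rw [ContinuousLinearMap.flip_apply] at this
  linarith

theorem WeakTendsto.norm_sq_le_of_tendsto {H : Type*} [NormedAddCommGroup H]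
    [InnerProductSpace ℝ H] {u : ℕ → H} {u₀ : H} (h : WeakTendsto u u₀)
    {c : ℕ → ℝ} {c₀ : ℝ} (hc : Tendsto c atTop (𝓝 c₀)) (hle : ∀ k, ‖u k‖ ^ 2 ≤ c k) :
    ‖u₀‖ ^ 2 ≤ c₀ := by
  have e : ∀ v : H, (innerSL ℝ : H →L[ℝ] H →L[ℝ] ℝ) v v = ‖v‖ ^ 2 := real_inner_self_eq_norm_sq
  have := h.le_of_tendsto (innerSL ℝ) (fun v => by rw [e]; positivity) hc
    (fun k => by rw [e]; exact hle k)
  rwa [e] at this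

theorem tendsto_bilin_weak_strong {H : Type*} [NormedAddCommGroup H] [NormedSpace ℝ H]
    {u : ℕ → H} {u₀ : H} (h : WeakTendsto u u₀) {C : ℝ} (hC : ∀ k, ‖u k‖ ≤ C)
    (B : H →L[ℝ] H →L[ℝ] ℝ) {v : ℕ → H} {v₀ : H} (hv : Tendsto v atTop (𝓝 v₀)) :
    Tendsto (fun k => B (u k) (v k)) atTop (𝓝 (B u₀ v₀)) := by
  have h1 := h (B.flip v₀)
  have h2 : Tendsto (fun k => B (u k) (v k - v₀)) atTop (𝓝 0) := by
    have h3 : Tendsto (fun k => ‖B‖ * C * ‖v k - v₀‖) atTop (𝓝 0) := by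
      have := (tendsto_iff_norm_sub_tendsto_zero.1 hv).const_mul (‖B‖ * C)
      simpa using this
    refine squeeze_zero_norm (fun k => ?_) h3
    refine (B.le_opNorm₂ _ _).trans ?_
    gcongr
    exact hC k
  have := h1.add h2
  simpa using this

theorem weakTendsto_fn_sub {u : ℕ → H10 Ω} {u₀ : H10 Ω} (h : WeakTendsto u u₀) (g : L2 Ω) :
    Tendsto (fun k => (inner ℝ g (fn (u k - u₀)) : ℝ)) atTop (𝓝 0) := by
  have := (h ((innerSL ℝ g).comp (fnL Ω))).sub_const (inner ℝ g (fn u₀))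
  simpa [fnL_apply, fn_sub, inner_sub_right] using this

/-- Rellich's theorem for weakly convergent sequences in `H₀¹(Ω)`. -/
theorem WeakTendsto.tendsto_fn (hΩ : Bornology.IsBounded (Ω : Set (Space n)))
    {u : ℕ → H10 Ω} {u₀ : H10 Ω} (h : WeakTendsto u u₀) {C : ℝ} (hC : ∀ k, ‖u k‖ ≤ C) :
    Tendsto (fun k => fn (u k)) atTop (𝓝 (fn u₀)) := by
  rw [tendsto_iff_norm_sub_tendsto_zero]
  exact tendsto_norm_fn_of_weak hΩ (fun k => u k - u₀) (C := C + ‖u₀‖)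
    (fun k => (norm_sub_le _ _).trans (by gcongr; exact hC k)) (weakTendsto_fn_sub h)

/-! ### The obstacle problem as limit of penalized problems -/

theorem betaLp_eq_smul {δ : ℝ} (hδ : 0 < δ) (u : L2 Ω) :
    betaLp hδ u = (1 / δ) • betaLp one_pos u := by
  apply Lp.ext
  filter_upwards [coeFn_betaLp hδ u, coeFn_betaLp one_pos u,
    Lp.coeFn_smul (1 / δ) (betaLp one_pos u)] with x h1 h2 h3
  rw [h1, h3, Pi.smul_apply, h2, beta_eq, smul_eq_mul]

theorem continuous_betaLp {δ : ℝ} (hδ : 0 < δ) : Continuous (betaLp (Ω := Ω) hδ) :=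
  (LipschitzWith.lipschitzWith_compLp (lipschitzWith_beta hδ) (beta_zero δ)).continuous

theorem le_of_inner_betaLp_eq_zero {u w : L2 Ω}
    (h : inner ℝ (betaLp one_pos (u - w)) (u - w) = 0) :
    (w : Space n → ℝ) ≤ᵐ[volume.restrict (Ω : Set (Space n))] u := by
  rw [← integral_mul_eq_inner, integral_eq_zero_iff_of_nonneg_ae ?_ (integrable_mul _ _)] at h
  · filter_upwards [h, coeFn_betaLp one_pos (u - w), Lp.coeFn_sub u w] with x h1 h2 h3
    rw [h2, h3] at h1
    have := nonneg_of_beta_one_mul_self_eq_zero h1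
    rw [Pi.sub_apply] at this
    linarith
  · filter_upwards [coeFn_betaLp one_pos (u - w)] with x h1
    rw [h1]
    exact beta_mul_self_nonneg one_pos _

/-- Limits of penalized states solve the obstacle problem. -/
theorem isObstacleState_of_tendsto {K : Coeffs n} (hK : K.Admissible Ω) {f : L2 Ω} {d : ℕ → ℝ}
    (hd : ∀ k, 0 < d k) (hd0 : Tendsto d atTop (𝓝 0)) {φ : ℕ → H10 Ω} {φ₀ : H10 Ω}
    (hφ : Tendsto φ atTop (𝓝 φ₀)) {y : ℕ → H10 Ω} {y₀ : H10 Ω}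
    (hy : ∀ k, IsPenalizedState K f (d k) (φ k) (y k)) {C : ℝ} (hC : ∀ k, ‖y k‖ ≤ C)
    (hyw : WeakTendsto y y₀) (hys : Tendsto (fun k => fn (y k)) atTop (𝓝 (fn y₀))) :
    IsObstacleState K f φ₀ y₀ := by
  obtain ⟨A, hA⟩ := exists_form_bilin hK
  obtain ⟨m, hm, hcoer⟩ := hK.coercive
  have hφs : Tendsto (fun k => fn (φ k)) atTop (𝓝 (fn φ₀)) :=
    ((fnL Ω).continuous.tendsto φ₀).comp hφ
  refine ⟨?_, fun w hw => ?_⟩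
  -- Multiplying the equation by `d k` gives `β₁(y_k - φ_k) = d_k (f - A y_k) → 0`, hence `β₁(y₀ -
  -- φ₀)` annihilates `H₀¹`, in particular `y₀ - φ₀`.
  · have hz : ∀ v : H10 Ω, inner ℝ (betaLp one_pos (fn y₀ - fn φ₀)) (fn v) = 0 := by
      intro v
      have h1 : Tendsto (fun k => inner ℝ (betaLp one_pos (fn (y k) - fn (φ k))) (fn v)) atTop
          (𝓝 (inner ℝ (betaLp one_pos (fn y₀ - fn φ₀)) (fn v))) :=
        (((continuous_betaLp one_pos).tendsto _).comp (hys.sub hφs)).inner tendsto_const_nhds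
      have h2 : Tendsto (fun k => d k * (inner ℝ f (fn v) - A (y k) v)) atTop (𝓝 0) := by
        have := hd0.mul ((tendsto_const_nhds (x := inner ℝ f (fn v))).sub (hyw (A.flip v)))
        simpa using this
      refine tendsto_nhds_unique h1 (h2.congr fun k => ?_)
      have h3 := (isPenalizedState_iff (hd k)).1 (hy k) v
      rw [betaLp_eq_smul, inner_smul_left] at h3
      rw [hA, ← h3]
      have := (hd k).ne'
      simp only [conj_trivial]
      field_simp
      ring
    exact le_of_inner_betaLp_eq_zero (hz (y₀ - φ₀))
  -- A competitor for `φ₀`, shifted by `φ_k - φ₀`, is a competitor for `φ_k`; strong convergence of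
  -- the obstacles makes it converge back to `w`.
  · have hwk : ∀ k, w + (φ k - φ₀) ∈ obstacleSet (φ k) := by
      intro k
      change _ ≤ᵐ[_] _
      filter_upwards [hw, Lp.coeFn_add (fn w) (fn (φ k - φ₀)),
        Lp.coeFn_sub (fn (φ k)) (fn φ₀)] with x h1 h2 h3
      rw [fn_add, h2, Pi.add_apply, fn_sub, h3, Pi.sub_apply]
      linarith
    have hdiff : Tendsto (fun k => w + (φ k - φ₀)) atTop (𝓝 w) := by
      have := (hφ.sub_const φ₀).const_add w
      simpa using this
    have hc : Tendsto (fun k => A (y k) (w + (φ k - φ₀))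
        - inner ℝ f (fn (w + (φ k - φ₀)) - fn (y k))) atTop
        (𝓝 (A y₀ w - inner ℝ f (fn w - fn y₀))) := by
      refine (tendsto_bilin_weak_strong hyw hC A hdiff).sub (tendsto_const_nhds.inner ?_)
      exact ((((fnL Ω).continuous.tendsto w).comp hdiff)).sub hys
    have := hyw.le_of_tendsto A (fun v => by
      rw [hA]; exact (mul_nonneg hm.le (sq_nonneg _)).trans (hcoer v)) hc fun k => by
        have h := (hy k).le_form (hd k) (hwk k)
        rw [← hA, map_sub (A (y k)), fn_sub] at h
        linarith
    rw [← hA, map_sub, fn_sub]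
    linarith

theorem tendsto_one_div_succ_pos : (∀ k : ℕ, (0 : ℝ) < 1 / (k + 1)) ∧
    Tendsto (fun k : ℕ => (1 : ℝ) / (k + 1)) atTop (𝓝 0) :=
  ⟨fun _ => Nat.one_div_pos_of_nat, tendsto_one_div_add_atTop_nhds_zero_nat⟩

/-- A solution is obtained by penalizing with `δ = 1/(k+1)` over a fixed obstacle and extracting a
weak limit. -/
theorem exists_isObstacleState (hΩ : Bornology.IsBounded (Ω : Set (Space n))) {K : Coeffs n}
    (hK : K.Admissible Ω) (f : L2 Ω) (φ : H10 Ω) : ∃ y, IsObstacleState K f φ y := by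
  obtain ⟨hd, hd0⟩ := tendsto_one_div_succ_pos
  choose y hy using fun k => exists_isPenalizedState hK f (hd k) φ
  obtain ⟨C, hC⟩ := exists_norm_penalizedState_le hK f ‖φ‖
  have hb : ∀ k, ‖y k‖ ≤ C := fun k => hC _ (hd k) φ (y k) le_rfl (hy k)
  obtain ⟨σ, y₀, hσ, hw⟩ := exists_weakTendsto_subseq hb
  exact ⟨y₀, isObstacleState_of_tendsto hK (fun k => hd (σ k)) (hd0.comp hσ.tendsto_atTop)
    tendsto_const_nhds (fun k => hy (σ k)) (fun k => hb (σ k)) hw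
    (hw.tendsto_fn hΩ fun k => hb (σ k))⟩

/-- The solution of the obstacle problem is Lipschitz in the obstacle. -/
theorem exists_obstacleState_lipschitz {K : Coeffs n} (hK : K.Admissible Ω) (f : L2 Ω) :
    ∃ C, ∀ φ₁ φ₂ y₁ y₂ : H10 Ω, IsObstacleState K f φ₁ y₁ → IsObstacleState K f φ₂ y₂ →
      ‖y₁ - y₂‖ ≤ C * ‖φ₁ - φ₂‖ := by
  obtain ⟨A, hA⟩ := exists_form_bilin hK
  obtain ⟨M, hM, hbd⟩ := exists_form_bound hK
  obtain ⟨m, hm, hcoer⟩ := hK.coercive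
  refine ⟨M / m, fun φ₁ φ₂ y₁ y₂ h₁ h₂ => ?_⟩
  have hmem : ∀ φ φ' y : H10 Ω, y ∈ obstacleSet φ → y + (φ' - φ) ∈ obstacleSet φ' := by
    intro φ φ' y hy
    change _ ≤ᵐ[_] _
    filter_upwards [hy, Lp.coeFn_add (fn y) (fn (φ' - φ)),
      Lp.coeFn_sub (fn φ') (fn φ)] with x h1 h2 h3
    rw [fn_add, h2, Pi.add_apply, fn_sub, h3, Pi.sub_apply]
    linarith
  -- Each solution, translated by the difference of the obstacles, competes with the other. In the
  -- sum of the two inequalities `f` cancels.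
  have e₁ := h₁.2 _ (hmem φ₂ φ₁ y₂ h₂.1)
  have e₂ := h₂.2 _ (hmem φ₁ φ₂ y₁ h₁.1)
  have hsum : inner ℝ f (fn (y₂ + (φ₁ - φ₂) - y₁)) + inner ℝ f (fn (y₁ + (φ₂ - φ₁) - y₂)) = 0 := by
    rw [← inner_add_right, ← fn_add]
    have : y₂ + (φ₁ - φ₂) - y₁ + (y₁ + (φ₂ - φ₁) - y₂) = 0 := by abel
    rw [this, ← fnL_apply, map_zero, inner_zero_right]
  have hform : form K y₁ (y₂ + (φ₁ - φ₂) - y₁) + form K y₂ (y₁ + (φ₂ - φ₁) - y₂)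
      = form K (y₁ - y₂) (φ₁ - φ₂) - form K (y₁ - y₂) (y₁ - y₂) := by
    simp only [← hA, map_sub, map_add, sub_apply]
    ring
  have h1 := hcoer (y₁ - y₂)
  have h2 := (le_abs_self _).trans (hbd (y₁ - y₂) (φ₁ - φ₂))
  have h3 : m * ‖y₁ - y₂‖ ^ 2 ≤ M * ‖y₁ - y₂‖ * ‖φ₁ - φ₂‖ := by linarith
  rcases (norm_nonneg (y₁ - y₂)).eq_or_lt with h0 | h0
  · rw [← h0]; positivity
  · rw [div_mul_eq_mul_div, le_div_iff₀ hm]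
    refine le_of_mul_le_mul_left ?_ h0
    linarith

/-- The set `𝒦(φ)` sees only the function part of `φ`, so equality in `L²` is enough; this is all
that the term `‖φ - φ*‖²` of `J_δ` provides. -/
theorem IsObstacleState.unique {K : Coeffs n} (hK : K.Admissible Ω) {f : L2 Ω} {φ₁ φ₂ y₁ y₂ : H10 Ω}
    (hφ : fn φ₁ = fn φ₂) (h₁ : IsObstacleState K f φ₁ y₁) (h₂ : IsObstacleState K f φ₂ y₂) :
    y₁ = y₂ := by
  obtain ⟨C, hC⟩ := exists_obstacleState_lipschitz hK f
  have hs : obstacleSet φ₁ = obstacleSet φ₂ := by unfold obstacleSet; rw [hφ]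
  have h₁' : IsObstacleState K f φ₂ y₁ := by
    unfold IsObstacleState at h₁ ⊢
    rwa [← hs]
  have := hC φ₂ φ₂ y₁ y₂ h₁' h₂
  rw [sub_self, norm_zero, mul_zero] at this
  exact sub_eq_zero.1 (norm_le_zero_iff.1 this)

/-! ### The chain rule in `H₀¹(Ω)` -/

theorem norm_sq_eq_integral (u : L2 Ω) : ‖u‖ ^ 2 = ∫ x in (Ω : Set (Space n)), u x ^ 2 := by
  rw [← real_inner_self_eq_norm_sq, ← integral_mul_eq_inner]
  simp_rw [sq]

theorem integrable_sq (u : L2 Ω) :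
    Integrable (fun x => u x ^ 2) (volume.restrict (Ω : Set (Space n))) := by
  simp_rw [sq]
  exact integrable_mul u u

/-- Multiplication by uniformly bounded, pointwise convergent factors preserves convergence
in `L²(Ω)`. -/
theorem tendsto_of_bounded_mul {a : ℕ → Space n → ℝ} {a₀ : Space n → ℝ} {L : ℝ}
    (hm : ∀ k, AEStronglyMeasurable (a k) (volume.restrict (Ω : Set (Space n))))
    (hm₀ : AEStronglyMeasurable a₀ (volume.restrict (Ω : Set (Space n))))
    (hL : ∀ k x, |a k x| ≤ L) (hL₀ : ∀ x, |a₀ x| ≤ L)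
    (ha : ∀ᵐ x ∂(volume.restrict (Ω : Set (Space n))), Tendsto (fun k => a k x) atTop (𝓝 (a₀ x)))
    {g w : ℕ → L2 Ω} {g₀ w₀ : L2 Ω} (hg : Tendsto g atTop (𝓝 g₀))
    (hw : ∀ k, (w k : Space n → ℝ) =ᵐ[volume.restrict (Ω : Set (Space n))]
      fun x => a k x * g k x)
    (hw₀ : (w₀ : Space n → ℝ) =ᵐ[volume.restrict (Ω : Set (Space n))] fun x => a₀ x * g₀ x) :
    Tendsto w atTop (𝓝 w₀) := by
  have hL0 : 0 ≤ L := (abs_nonneg _).trans (hL₀ 0)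
  have hdom : Integrable (fun x => (2 * L) ^ 2 * g₀ x ^ 2)
      (volume.restrict (Ω : Set (Space n))) := (integrable_sq g₀).const_mul _
  have hFm : ∀ k, AEStronglyMeasurable (fun x => ((a k x - a₀ x) * g₀ x) ^ 2)
      (volume.restrict (Ω : Set (Space n))) := fun k =>
    (((hm k).sub hm₀).mul (Lp.aestronglyMeasurable g₀)).pow 2
  have hle : ∀ k x, ((a k x - a₀ x) * g₀ x) ^ 2 ≤ (2 * L) ^ 2 * g₀ x ^ 2 := by
    intro k x
    rw [mul_pow]
    refine mul_le_mul_of_nonneg_right ?_ (sq_nonneg _)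
    rw [← sq_abs]
    refine pow_le_pow_left₀ (abs_nonneg _) ?_ 2
    exact (abs_sub _ _).trans (by linarith [hL k x, hL₀ x])
  have h1 : Tendsto (fun k => ∫ x in (Ω : Set (Space n)), ((a k x - a₀ x) * g₀ x) ^ 2) atTop
      (𝓝 0) := by
    have := tendsto_integral_of_dominated_convergence (f := fun _ => (0 : ℝ)) _ hFm hdom
      (fun k => Eventually.of_forall fun x => by
        rw [Real.norm_eq_abs, abs_of_nonneg (sq_nonneg _)]; exact hle k x)
      (by
        filter_upwards [ha] with x hx
        have := ((hx.sub_const (a₀ x)).mul_const (g₀ x)).pow 2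
        simpa using this)
    simpa using this
  have h2 : Tendsto (fun k => 2 * L ^ 2 * ‖g k - g₀‖ ^ 2
      + 2 * ∫ x in (Ω : Set (Space n)), ((a k x - a₀ x) * g₀ x) ^ 2) atTop (𝓝 0) := by
    have := (((tendsto_iff_norm_sub_tendsto_zero.1 hg).pow 2).const_mul (2 * L ^ 2)).add
      (h1.const_mul 2)
    simpa using this
  rw [tendsto_iff_norm_sub_tendsto_zero]
  -- From `a_k g_k - a₀ g₀ = a_k (g_k - g₀) + (a_k - a₀) g₀` and `(s + t)² ≤ 2s² + 2t²`.
  have h3 : ∀ k, ‖w k - w₀‖ ^ 2 ≤ 2 * L ^ 2 * ‖g k - g₀‖ ^ 2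
      + 2 * ∫ x in (Ω : Set (Space n)), ((a k x - a₀ x) * g₀ x) ^ 2 := by
    intro k
    have hF : Integrable (fun x => ((a k x - a₀ x) * g₀ x) ^ 2)
        (volume.restrict (Ω : Set (Space n))) :=
      hdom.mono' (hFm k) (Eventually.of_forall fun x => by
        rw [Real.norm_eq_abs, abs_of_nonneg (sq_nonneg _)]; exact hle k x)
    rw [norm_sq_eq_integral, norm_sq_eq_integral, ← integral_const_mul, ← integral_const_mul,
      ← integral_add ((integrable_sq _).const_mul _) (hF.const_mul _)]
    refine integral_mono_ae (integrable_sq _)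
      (((integrable_sq _).const_mul _).add (hF.const_mul _)) ?_
    filter_upwards [Lp.coeFn_sub (w k) w₀, Lp.coeFn_sub (g k) g₀, hw k, hw₀] with x e1 e2 e3 e4
    rw [e1, e2, Pi.sub_apply, Pi.sub_apply, e3, e4]
    have h5 : (a k x) ^ 2 ≤ L ^ 2 := by
      rw [← sq_abs]; exact pow_le_pow_left₀ (abs_nonneg _) (hL k x) 2
    have h6 := mul_le_mul_of_nonneg_right h5 (sq_nonneg (g k x - g₀ x))
    nlinarith [sq_nonneg (a k x * (g k x - g₀ x) - (a k x - a₀ x) * g₀ x)]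
  have h4 := (squeeze_zero (fun k => sq_nonneg _) h3 h2).sqrt
  simpa [Real.sqrt_sq] using h4

/-- The composition of a test function with a smooth function vanishing at zero. -/
def testComp {S : ℝ → ℝ} (hS : ContDiff ℝ ((⊤ : ℕ∞) : WithTop ℕ∞) S) (h0 : S 0 = 0) (ψ : 𝓓(Ω, ℝ)) : 𝓓(Ω, ℝ) where
  toFun := S ∘ ψ
  contDiff' := hS.comp ψ.contDiff
  hasCompactSupport' := ψ.hasCompactSupport.comp_left h0
  tsupport_subset' := (tsupport_comp_subset h0 _).trans ψ.tsupport_subset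

theorem partialDeriv_testComp {S : ℝ → ℝ} (hS : ContDiff ℝ ((⊤ : ℕ∞) : WithTop ℕ∞) S) (h0 : S 0 = 0) (ψ : 𝓓(Ω, ℝ))
    (i : Fin n) (x : Space n) :
    partialDeriv i (testComp hS h0 ψ) x = deriv S (ψ x) * partialDeriv i ψ x := by
  have h1 : HasFDerivAt (ψ : Space n → ℝ) (fderiv ℝ ψ x) x :=
    (ψ.contDiff.differentiable (by simp) x).hasFDerivAt
  have h2 : HasDerivAt S (deriv S (ψ x)) (ψ x) :=
    (hS.differentiable (by simp) _).hasDerivAt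
  have h3 : fderiv ℝ (testComp hS h0 ψ) x = _ := (h2.comp_hasFDerivAt x h1).fderiv
  unfold partialDeriv
  rw [h3]
  simp

/-- The chain rule in `H₀¹(Ω)`. -/
theorem exists_chain {S : ℝ → ℝ} (hS : ContDiff ℝ ((⊤ : ℕ∞) : WithTop ℕ∞) S) (h0 : S 0 = 0) {L : ℝ}
    (hL : ∀ t, |deriv S t| ≤ L) (u : H10 Ω) :
    ∃ w : H10 Ω,
      (fn w : Space n → ℝ) =ᵐ[volume.restrict (Ω : Set (Space n))] (fun x => S (fn u x)) ∧
      ∀ i, (grad w i : Space n → ℝ) =ᵐ[volume.restrict (Ω : Set (Space n))]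
        fun x => deriv S (fn u x) * grad u i x := by
  have hL0 : 0 ≤ L := (abs_nonneg _).trans (hL 0)
  have hLip : LipschitzWith ⟨L, hL0⟩ S :=
    lipschitzWith_of_nnnorm_deriv_le (hS.differentiable (by simp)) fun t => hL t
  have hS'c : Continuous (deriv S) := hS.continuous_deriv (by simp)
  obtain ⟨hd, hd0⟩ := tendsto_one_div_succ_pos
  choose ψ' v' hv' hclose using fun k => exists_test_near u (hd k)
  have hv'u : Tendsto v' atTop (𝓝 u) := by
    rw [tendsto_iff_norm_sub_tendsto_zero]
    exact squeeze_zero (fun _ => norm_nonneg _) (fun k => (hclose k).le) hd0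
  -- Along an a.e. convergent subsequence the bounded factors `S'(v_k)` converge a.e., so the
  -- gradients `S'(v_k) ∇v_k` converge in `L²`.
  obtain ⟨σ, hσ, hae⟩ := (tendstoInMeasure_of_tendsto_Lp
    (((fnL Ω).continuous.tendsto u).comp hv'u)).exists_seq_tendsto_ae
  set ψ := ψ' ∘ σ
  set v := v' ∘ σ
  have hvu : Tendsto v atTop (𝓝 u) := hv'u.comp hσ.tendsto_atTop
  have hv : ∀ k, IsJetOf (v k) (ψ k) := fun k => hv' (σ k)
  choose w hw using fun k => exists_isJetOf (testComp hS h0 (ψ k))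
  have hmeas : ∀ u : H10 Ω, AEStronglyMeasurable (fun x => deriv S (fn u x))
      (volume.restrict (Ω : Set (Space n))) := fun u =>
    hS'c.comp_aestronglyMeasurable (Lp.aestronglyMeasurable (fn u))
  have hG : ∀ i, MemLp (fun x => deriv S (fn u x) * grad u i x) 2
      (volume.restrict (Ω : Set (Space n))) := fun i =>
    (Lp.memLp (grad u i)).of_le_mul (c := L)
      ((hmeas u).mul (Lp.aestronglyMeasurable (grad u i))) (Eventually.of_forall fun x => by
        rw [norm_mul]
        exact mul_le_mul_of_nonneg_right (hL _) (norm_nonneg _))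
  have hfn : Tendsto (fun k => fn (w k)) atTop (𝓝 (hLip.compLp h0 (fn u))) := by
    have h1 := ((LipschitzWith.lipschitzWith_compLp (p := 2)
      (μ := volume.restrict (Ω : Set (Space n))) hLip h0).continuous.tendsto (fn u)).comp
      (((fnL Ω).continuous.tendsto u).comp hvu)
    refine h1.congr fun k => ?_
    apply Lp.ext
    filter_upwards [hLip.coeFn_compLp h0 (fn (v k)), (hw k).1, (hv k).1] with x e1 e2 e3
    refine e1.trans ?_
    rw [Function.comp_apply, e2, e3]
    rfl
  have hgr : ∀ i, Tendsto (fun k => grad (w k) i) atTop (𝓝 ((hG i).toLp _)) := by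
    intro i
    refine tendsto_of_bounded_mul (a := fun k x => deriv S (fn (v k) x))
      (a₀ := fun x => deriv S (fn u x)) (fun k => hmeas (v k)) (hmeas u) (fun k x => hL _)
      (fun x => hL _) ?_ (((gradL Ω i).continuous.tendsto u).comp hvu) (fun k => ?_)
      (hG i).coeFn_toLp
    · filter_upwards [hae] with x hx
      exact (hS'c.tendsto _).comp hx
    · filter_upwards [(hw k).2 i, (hv k).1, (hv k).2 i] with x e1 e2 e3
      rw [e1, partialDeriv_testComp, e2, Function.comp_apply, gradL_apply, e3]
  let W : Jet1 Ω := WithLp.toLp 2 (hLip.compLp h0 (fn u), WithLp.toLp 2 fun i => (hG i).toLp _)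
  have hW : W ∈ H10 Ω := by
    have hc : IsClosed (H10 Ω : Set (Jet1 Ω)) := Submodule.isClosed_topologicalClosure _
    refine hc.mem_of_tendsto (b := atTop) (f := fun k => (w k : Jet1 Ω)) ?_
      (Eventually.of_forall fun k => (w k).2)
    rw [tendsto_iff_norm_sub_tendsto_zero]
    have hn : ∀ k, ‖(w k : Jet1 Ω) - W‖ ^ 2 = ‖fn (w k) - hLip.compLp h0 (fn u)‖ ^ 2
        + ∑ i, ‖grad (w k) i - (hG i).toLp _‖ ^ 2 := by
      intro k
      rw [WithLp.prod_norm_sq_eq_of_L2, PiLp.norm_sq_eq_of_L2]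
      rfl
    have h1 : Tendsto (fun k => ‖(w k : Jet1 Ω) - W‖ ^ 2) atTop (𝓝 0) := by
      simp_rw [hn]
      have h2 := ((tendsto_iff_norm_sub_tendsto_zero.1 hfn).pow 2).add
        (tendsto_finsetSum Finset.univ fun i _ =>
          (tendsto_iff_norm_sub_tendsto_zero.1 (hgr i)).pow 2)
      simpa using h2
    simpa [Real.sqrt_sq] using h1.sqrt
  exact ⟨⟨W, hW⟩, hLip.coeFn_compLp h0 (fn u), fun i => (hG i).coeFn_toLp⟩

/-! ### The `L¹` bound for the multipliers -/

theorem memLp_multiplier {δ : ℝ} (hδ : 0 < δ) (φ y p : H10 Ω) :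
    MemLp (multiplier δ φ y p) 2 (volume.restrict (Ω : Set (Space n))) := by
  refine (Lp.memLp (fn p)).of_le_mul (c := 1 / δ) ?_ (Eventually.of_forall fun x => ?_)
  · refine AEStronglyMeasurable.mul ?_ (Lp.aestronglyMeasurable (fn p))
    exact ((measurable_betaDeriv δ).comp_aemeasurable
      ((Lp.aestronglyMeasurable (fn y)).aemeasurable.sub
        (Lp.aestronglyMeasurable (fn φ)).aemeasurable)).aestronglyMeasurable
  · rw [multiplier, norm_mul, Real.norm_eq_abs, abs_of_nonneg (betaDeriv_nonneg hδ _)]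
    exact mul_le_mul_of_nonneg_right (betaDeriv_le hδ _) (norm_nonneg _)

theorem integrable_multiplier (hΩ : Bornology.IsBounded (Ω : Set (Space n))) {δ : ℝ} (hδ : 0 < δ)
    (φ y p : H10 Ω) :
    Integrable (multiplier δ φ y p) (volume.restrict (Ω : Set (Space n))) := by
  have : IsFiniteMeasure (volume.restrict (Ω : Set (Space n))) :=
    isFiniteMeasure_restrict.2 hΩ.measure_lt_top.ne
  exact (memLp_multiplier hδ φ y p).integrable (by norm_num)

/-- Smooth approximations `arctan (N t)` of `(π / 2) sign t`. -/
def smoothSign (N : ℕ) (t : ℝ) : ℝ := Real.arctan (N * t)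

theorem contDiff_smoothSign (N : ℕ) : ContDiff ℝ ((⊤ : ℕ∞) : WithTop ℕ∞) (smoothSign N) :=
  Real.contDiff_arctan.comp (contDiff_const.mul contDiff_id)

theorem smoothSign_zero (N : ℕ) : smoothSign N 0 = 0 := by simp [smoothSign]

theorem deriv_smoothSign (N : ℕ) (t : ℝ) :
    deriv (smoothSign N) t = N / (1 + (N * t) ^ 2) := by
  have h := ((hasDerivAt_id t).const_mul (N : ℝ)).arctan
  have := h.deriv
  simp only [id_eq, mul_one] at this
  unfold smoothSign
  rw [this]; ring

theorem deriv_smoothSign_nonneg (N : ℕ) (t : ℝ) : 0 ≤ deriv (smoothSign N) t := by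
  rw [deriv_smoothSign]; positivity

theorem abs_deriv_smoothSign_le (N : ℕ) (t : ℝ) : |deriv (smoothSign N) t| ≤ N := by
  rw [abs_of_nonneg (deriv_smoothSign_nonneg N t), deriv_smoothSign]
  exact div_le_self (by positivity) (by nlinarith [sq_nonneg (N * t)])

/-- With `s = N t` the product is `s / (1 + s²)`. This bound provides the majorant for the first
order term. -/
theorem abs_deriv_smoothSign_mul_le (N : ℕ) (t : ℝ) : |deriv (smoothSign N) t * t| ≤ 1 := by
  rw [deriv_smoothSign, div_mul_eq_mul_div, abs_div, abs_of_pos (by positivity : 0 < 1 + (N * t) ^ 2),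
    div_le_one (by positivity)]
  nlinarith [sq_abs (N * t), sq_nonneg (|N * t| - 1)]

theorem tendsto_deriv_smoothSign_mul (t : ℝ) :
    Tendsto (fun N : ℕ => deriv (smoothSign N) t * t) atTop (𝓝 0) := by
  rcases eq_or_ne t 0 with rfl | ht
  · simp
  have h1 : Tendsto (fun N : ℕ => (1 / |t|) * (1 / (N : ℝ))) atTop (𝓝 0) := by
    simpa using (tendsto_one_div_atTop_nhds_zero_nat (𝕜 := ℝ)).const_mul (1 / |t|)
  refine squeeze_zero_norm' ?_ h1
  filter_upwards [eventually_gt_atTop 0] with N hN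
  have hN' : (0 : ℝ) < N := by exact_mod_cast hN
  have ht' : 0 < |t| := abs_pos.2 ht
  rw [deriv_smoothSign, Real.norm_eq_abs, div_mul_eq_mul_div, abs_div,
    abs_of_pos (by positivity : 0 < 1 + (N * t) ^ 2), div_mul_div_comm, one_mul,
    div_le_div_iff₀ (by positivity) (by positivity), abs_mul, abs_of_pos hN']
  have : (N * t) ^ 2 = N ^ 2 * |t| ^ 2 := by rw [mul_pow, sq_abs]
  rw [this]
  nlinarith

theorem smoothSign_mul_self_nonneg (N : ℕ) (t : ℝ) : 0 ≤ smoothSign N t * t := by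
  unfold smoothSign
  rcases le_total 0 t with h | h
  · exact mul_nonneg (Real.arctan_nonneg.2 (by positivity)) h
  · exact mul_nonneg_of_nonpos_of_nonpos
      (Real.arctan_zero ▸ Real.arctan_strictMono.monotone
        (mul_nonpos_of_nonneg_of_nonpos (by positivity) h)) h

theorem abs_smoothSign_le (N : ℕ) (t : ℝ) : |smoothSign N t| ≤ 2 := by
  have h1 := Real.arctan_lt_pi_div_two (N * t)
  have h2 := Real.neg_pi_div_two_lt_arctan (N * t)
  have h3 := Real.pi_lt_four
  unfold smoothSign
  rw [abs_le]
  constructor <;> linarith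

theorem tendsto_smoothSign_mul_self (t : ℝ) :
    Tendsto (fun N : ℕ => smoothSign N t * t) atTop (𝓝 (Real.pi / 2 * |t|)) := by
  have hpos : ∀ s : ℝ, 0 < s → Tendsto (fun N : ℕ => smoothSign N s) atTop (𝓝 (Real.pi / 2)) :=
    fun s hs => (tendsto_nhds_of_tendsto_nhdsWithin Real.tendsto_arctan_atTop).comp
      (tendsto_natCast_atTop_atTop.atTop_mul_const hs)
  rcases lt_trichotomy t 0 with h | rfl | h
  · have h1 := (hpos (-t) (neg_pos.2 h)).mul_const (-t)
    rw [abs_of_neg h]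
    refine h1.congr fun N => ?_
    unfold smoothSign
    rw [mul_neg (N : ℝ) t, Real.arctan_neg, neg_mul_neg]
  · simp
  · rw [abs_of_pos h]
    exact (hpos t h).mul_const t

/-- With `w = S(p)`, the second order part of `a(w, p)` is `S'(p) ∑ aᵢⱼ ∂ᵢp ∂ⱼp ≥ 0` and the zeroth
order part is `a₀ S(p) p ≥ 0`. Only the first order part lacks a sign and is kept. -/
theorem le_form_smoothSign {K : Coeffs n} (hK : K.Admissible Ω) {p w : H10 Ω} (N : ℕ)
    (h1 : (fn w : Space n → ℝ) =ᵐ[volume.restrict (Ω : Set (Space n))]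
      fun x => smoothSign N (fn p x))
    (h2 : ∀ i, (grad w i : Space n → ℝ) =ᵐ[volume.restrict (Ω : Set (Space n))]
      fun x => deriv (smoothSign N) (fn p x) * grad p i x) :
    ∑ i, ∫ x in (Ω : Set (Space n)), K.b i x * grad p i x * (deriv (smoothSign N) (fn p x) * fn p x)
      ≤ form K w p := by
  have hA : 0 ≤ ∑ i, ∑ j, ∫ x in (Ω : Set (Space n)), K.a i j x * grad w i x * grad p j x := by
    rw [show ∑ i, ∑ j, ∫ x in (Ω : Set (Space n)), K.a i j x * grad w i x * grad p j x
        = ∫ x in (Ω : Set (Space n)), ∑ i, ∑ j, K.a i j x * grad w i x * grad p j x from ?_]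
    · obtain ⟨m, hm, hell⟩ := hK.elliptic
      refine integral_nonneg_of_ae ?_
      filter_upwards [hell, eventually_countable_forall.2 h2] with x hx hx2
      have hs := hx (fun i => grad p i x)
      have h0 : 0 ≤ m * ∑ i, (grad p i x) ^ 2 :=
        mul_nonneg hm.le (Finset.sum_nonneg fun i _ => sq_nonneg _)
      have e : ∑ i, ∑ j, K.a i j x * grad w i x * grad p j x = deriv (smoothSign N) (fn p x)
          * ∑ i, ∑ j, K.a i j x * grad p i x * grad p j x := by
        simp_rw [Finset.mul_sum]
        refine Finset.sum_congr rfl fun i _ => Finset.sum_congr rfl fun j _ => ?_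
        rw [hx2 i]; ring
      rw [e]
      exact mul_nonneg (deriv_smoothSign_nonneg N _) (h0.trans hs)
    · rw [integral_finsetSum _ fun i _ => integrable_finsetSum _ fun j _ =>
        integrable_weight_mul (hK.bdd_a i j) (grad w i) (grad p j)]
      refine Finset.sum_congr rfl fun i _ => ?_
      rw [integral_finsetSum _ fun j _ =>
        integrable_weight_mul (hK.bdd_a i j) (grad w i) (grad p j)]
  have hC : 0 ≤ ∫ x in (Ω : Set (Space n)), K.c x * fn w x * fn p x := by
    refine integral_nonneg_of_ae ?_
    filter_upwards [hK.nonneg_c, h1] with x hx hx1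
    rw [hx1, mul_assoc]
    exact mul_nonneg hx (smoothSign_mul_self_nonneg N _)
  have hB : ∑ i, ∫ x in (Ω : Set (Space n)),
      K.b i x * grad p i x * (deriv (smoothSign N) (fn p x) * fn p x)
      = ∑ i, ∫ x in (Ω : Set (Space n)), K.b i x * grad w i x * fn p x := by
    refine Finset.sum_congr rfl fun i _ => integral_congr_ae ?_
    filter_upwards [h2 i] with x hx
    rw [hx]; ring
  rw [hB]
  unfold form
  linarith

/-- Dominated convergence with majorant `|aᵢ ∂ᵢp|`, integrable because `Ω` has finite measure. No
smallness of the first order coefficients is involved. -/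
theorem tendsto_first_order {K : Coeffs n} (hK : K.Admissible Ω)
    (hΩ : Bornology.IsBounded (Ω : Set (Space n))) (p : H10 Ω) :
    Tendsto (fun N : ℕ => ∑ i, ∫ x in (Ω : Set (Space n)),
      K.b i x * grad p i x * (deriv (smoothSign N) (fn p x) * fn p x)) atTop (𝓝 0) := by
  have : IsFiniteMeasure (volume.restrict (Ω : Set (Space n))) :=
    isFiniteMeasure_restrict.2 hΩ.measure_lt_top.ne
  rw [show (0 : ℝ) = ∑ i : Fin n, ∫ x in (Ω : Set (Space n)), (0 : ℝ) by simp]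
  refine tendsto_finsetSum _ fun i _ => ?_
  have hint : Integrable (fun x => K.b i x * grad p i x)
      (volume.restrict (Ω : Set (Space n))) :=
    (MemLp.mul (p := ∞) (q := 2) (r := 2) (Lp.memLp (grad p i)) (hK.bdd_b i)).integrable
      (by norm_num)
  refine tendsto_integral_of_dominated_convergence _ (fun N => ?_) hint.norm
    (fun N => Eventually.of_forall fun x => ?_) (Eventually.of_forall fun x => ?_)
  · refine hint.aestronglyMeasurable.mul (AEStronglyMeasurable.mul ?_ (Lp.aestronglyMeasurable _))
    exact ((contDiff_smoothSign N).continuous_deriv (by simp)).comp_aestronglyMeasurable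
      (Lp.aestronglyMeasurable (fn p))
  · rw [norm_mul]
    exact mul_le_of_le_one_right (norm_nonneg _) (abs_deriv_smoothSign_mul_le N _)
  · simpa using (tendsto_deriv_smoothSign_mul (fn p x)).const_mul (K.b i x * grad p i x)

/-- The `L¹` bound for multipliers. -/
theorem IsAdjointState.integral_abs_multiplier_le {K : Coeffs n} (hK : K.Admissible Ω)
    (hΩ : Bornology.IsBounded (Ω : Set (Space n))) {z : L2 Ω} {δ : ℝ} (hδ : 0 < δ)
    {φ y p : H10 Ω} (h : IsAdjointState K z δ φ y p) :
    ∫ x in (Ω : Set (Space n)), |multiplier δ φ y p x|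
      ≤ ‖fn y - z‖ * (2 * √(volume.real (Ω : Set (Space n)))) := by
  have : IsFiniteMeasure (volume.restrict (Ω : Set (Space n))) :=
    isFiniteMeasure_restrict.2 hΩ.measure_lt_top.ne
  set B := ‖fn y - z‖ * (2 * √(volume.real (Ω : Set (Space n)))) with hB
  choose w hw1 hw2 using fun N : ℕ => exists_chain (contDiff_smoothSign N) (smoothSign_zero N)
    (abs_deriv_smoothSign_le N) p
  have hmul := integrable_multiplier hΩ hδ φ y p
  have hle : ∀ N, ∫ x in (Ω : Set (Space n)), multiplier δ φ y p x * smoothSign N (fn p x)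
      ≤ B - ∑ i, ∫ x in (Ω : Set (Space n)),
        K.b i x * grad p i x * (deriv (smoothSign N) (fn p x) * fn p x) := by
    intro N
    have e := h (w N)
    have e1 : ∫ x in (Ω : Set (Space n)), multiplier δ φ y p x * smoothSign N (fn p x)
        = ∫ x in (Ω : Set (Space n)), multiplier δ φ y p x * fn (w N) x := by
      refine integral_congr_ae ?_
      filter_upwards [hw1 N] with x hx
      rw [hx]
    have e2 := le_form_smoothSign hK N (hw1 N) (hw2 N)
    -- The factor 2 in `B` is the crude bound `|arctan| ≤ π/2 ≤ 2`.
    have e3 : inner ℝ (fn y - z) (fn (w N)) ≤ B := by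
      refine (real_inner_le_norm _ _).trans (mul_le_mul_of_nonneg_left ?_ (norm_nonneg _))
      refine (sq_le_sq₀ (norm_nonneg _) (by positivity)).1 ?_
      rw [norm_sq_eq_integral, mul_pow, Real.sq_sqrt measureReal_nonneg]
      calc ∫ x in (Ω : Set (Space n)), fn (w N) x ^ 2
          ≤ ∫ x in (Ω : Set (Space n)), (2 : ℝ) ^ 2 := by
            refine integral_mono_ae (integrable_sq _) (integrable_const _) ?_
            filter_upwards [hw1 N] with x hx
            rw [hx, ← sq_abs]
            exact pow_le_pow_left₀ (abs_nonneg _) (abs_smoothSign_le N _) 2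
        _ = 2 ^ 2 * volume.real (Ω : Set (Space n)) := by
            simp [Measure.real, mul_comm]
    unfold adjForm at e
    linarith
  have hlim : Tendsto (fun N : ℕ => ∫ x in (Ω : Set (Space n)),
      multiplier δ φ y p x * smoothSign N (fn p x)) atTop
      (𝓝 (∫ x in (Ω : Set (Space n)), Real.pi / 2 * |multiplier δ φ y p x|)) := by
    refine tendsto_integral_of_dominated_convergence (fun x => 2 * |multiplier δ φ y p x|)
      (fun N => ?_) (hmul.abs.const_mul 2) (fun N => Eventually.of_forall fun x => ?_)
      (Eventually.of_forall fun x => ?_)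
    · exact hmul.aestronglyMeasurable.mul
        ((contDiff_smoothSign N).continuous.comp_aestronglyMeasurable
          (Lp.aestronglyMeasurable (fn p)))
    · rw [norm_mul, mul_comm]
      exact mul_le_mul_of_nonneg_right (abs_smoothSign_le N _) (norm_nonneg _)
    · have h1 := (tendsto_smoothSign_mul_self (fn p x)).const_mul
        (betaDeriv δ (fn y x - fn φ x))
      have e : Real.pi / 2 * |multiplier δ φ y p x|
          = betaDeriv δ (fn y x - fn φ x) * (Real.pi / 2 * |fn p x|) := by
        rw [multiplier, abs_mul, abs_of_nonneg (betaDeriv_nonneg hδ _)]; ring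
      rw [e]
      refine h1.congr fun N => ?_
      rw [multiplier]; ring
  -- The limit is `(π/2) ∫ |μ| ≤ B`, and `π/2 ≥ 1`.
  have h2 := le_of_tendsto_of_tendsto' hlim ((tendsto_first_order hK hΩ p).const_sub B) hle
  rw [integral_const_mul, sub_zero] at h2
  have h3 : 0 ≤ ∫ x in (Ω : Set (Space n)), |multiplier δ φ y p x| :=
    integral_nonneg fun x => abs_nonneg _
  nlinarith [Real.pi_gt_three]

/-! ### Weak-* compactness of measures on `Ω` -/

/-- Bounded sequences of finite measures on a compact metric space have weakly convergent
subsequences. -/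
theorem exists_subseq_tendsto_integral {E : Type*} [MetricSpace E] [CompactSpace E]
    [MeasurableSpace E] [BorelSpace E] (μ : ℕ → FiniteMeasure E) {C : NNReal}
    (hC : ∀ k, (μ k).mass ≤ C) :
    ∃ (σ : ℕ → ℕ) (ν : FiniteMeasure E), StrictMono σ ∧ ∀ g : C(E, ℝ),
      Tendsto (fun k => ∫ x, g x ∂(μ (σ k) : Measure E)) atTop (𝓝 (∫ x, g x ∂(ν : Measure E))) := by
  have hint : ∀ (μ : FiniteMeasure E) (g : C(E, ℝ)), Integrable g (μ : Measure E) := fun μ g =>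
    Integrable.of_bound g.continuous.aestronglyMeasurable ‖g‖
      (Eventually.of_forall g.norm_coe_le_norm)
  let T : ℕ → StrongDual ℝ C(E, ℝ) := fun k => LinearMap.mkContinuous
    { toFun := fun g => ∫ x, g x ∂(μ k : Measure E)
      map_add' := fun g h => integral_add (hint _ g) (hint _ h)
      map_smul' := fun c g => integral_const_mul c _ } C fun g => by
        change ‖∫ x, g x ∂(μ k : Measure E)‖ ≤ _
        have h1 := norm_integral_le_of_norm_le_const (μ := (μ k : Measure E))
          (Eventually.of_forall g.norm_coe_le_norm)
        have h2 : (μ k : Measure E).real Set.univ ≤ C := NNReal.coe_le_coe.2 (hC k)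
        calc _ ≤ ‖g‖ * (μ k : Measure E).real Set.univ := h1
          _ ≤ C * ‖g‖ := by rw [mul_comm]; gcongr
  have hT : ∀ k, ‖T k‖ ≤ C := fun k => LinearMap.mkContinuous_norm_le _ C.2 _
  -- Sequential Banach–Alaoglu on the separable space `C(E)` yields the subsequence, but only a
  -- functional as limit.
  obtain ⟨T₀, -, σ, hσ, hlim⟩ := (WeakDual.isSeqCompact_closedBall ℝ C(E, ℝ) 0 C)
    (x := fun k => StrongDual.toWeakDual (T k)) (fun k => by simpa using hT k)
  -- Compactness of finite measures yields a limit measure along an ultrafilter finer than `atTop`,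
  -- which must represent the functional `T₀`.
  obtain ⟨ν, -, hν⟩ := (isCompact_setOfPred_finiteMeasure_le_of_compactSpace E C).ultrafilter_le_nhds
    ((hyperfilter ℕ).map (μ ∘ σ)) (by
      rw [le_principal_iff]
      change ∀ᶠ k in (hyperfilter ℕ : Filter ℕ), ((μ ∘ σ) k).mass ≤ C
      exact Eventually.of_forall fun k => hC (σ k))
  refine ⟨σ, ν, hσ, fun g => ?_⟩
  have h1 : Tendsto (fun k => ∫ x, g x ∂(μ (σ k) : Measure E)) atTop (𝓝 (T₀ g)) :=
    ((WeakDual.eval_continuous g).tendsto T₀).comp hlim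
  have h2 : Tendsto (fun k => ∫ x, g x ∂(μ (σ k) : Measure E)) (hyperfilter ℕ)
      (𝓝 (∫ x, g x ∂(ν : Measure E))) :=
    ((FiniteMeasure.continuous_integral_continuousMap g).tendsto ν).comp hν
  rwa [tendsto_nhds_unique h2 (h1.mono_left Nat.hyperfilter_le_atTop)]

/-- The extension by zero of a function in `C₀(Ω)`. -/
def extendZero (g : C₀(Ω, ℝ)) (x : Space n) : ℝ :=
  Function.extend Subtype.val g 0 x

theorem extendZero_coe (g : C₀(Ω, ℝ)) (x : Ω) : extendZero g x = g x :=
  Subtype.val_injective.extend_apply _ _ _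

theorem extendZero_of_notMem (g : C₀(Ω, ℝ)) {x : Space n} (hx : x ∉ Ω) : extendZero g x = 0 :=
  Function.extend_apply' _ _ _ fun ⟨y, hy⟩ => hx (hy ▸ y.2)

/-- Near a point outside `Ω`: the set where `|g| ≥ ε` lies in a compact subset of `Ω`, whose
complement is a neighbourhood of the point. -/
theorem continuous_extendZero (g : C₀(Ω, ℝ)) : Continuous (extendZero g) := by
  rw [continuous_iff_continuousAt]
  intro x
  by_cases hx : x ∈ Ω
  · have ho : IsOpenEmbedding (Subtype.val : Ω → Space n) := Ω.isOpen.isOpenEmbedding_subtypeVal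
    rw [← ho.continuousAt_iff (x := ⟨x, hx⟩)]
    have : extendZero g ∘ Subtype.val = g := funext fun y => extendZero_coe g y
    rw [this]
    exact g.continuous.continuousAt
  · rw [ContinuousAt, extendZero_of_notMem g hx, Metric.tendsto_nhds]
    intro ε hε
    have h := (Metric.tendsto_nhds.1 (zero_at_infty g)) ε hε
    obtain ⟨k, hk, hkε⟩ := mem_cocompact.1 h
    have hcl : IsClosed ((Subtype.val : Ω → Space n) '' k) :=
      (hk.image continuous_subtype_val).isClosed
    have hxk : x ∈ ((Subtype.val : Ω → Space n) '' k)ᶜ := fun ⟨y, _, hy⟩ => hx (hy ▸ y.2)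
    filter_upwards [hcl.isOpen_compl.mem_nhds hxk] with y hy
    by_cases hyΩ : y ∈ Ω
    · have : (⟨y, hyΩ⟩ : Ω) ∈ kᶜ := fun hmem => hy ⟨_, hmem, rfl⟩
      have := hkε this
      rw [show extendZero g y = g ⟨y, hyΩ⟩ from extendZero_coe g ⟨y, hyΩ⟩]
      exact this
    · rw [extendZero_of_notMem g hyΩ, dist_self]
      exact hε

/-- The densities are pushed to the compact closure of `Ω`, where bounded mass gives compactness,
and the limit is restricted to `Ω`. Mass escaping to the boundary is invisible to `C₀(Ω)`. -/
theorem exists_subseq_density (hΩ : Bornology.IsBounded (Ω : Set (Space n))) {h : ℕ → Ω → ℝ}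
    (hint : ∀ k, Integrable (h k) (volOn Ω)) (h0 : ∀ k x, 0 ≤ h k x) {C : ℝ}
    (hC : ∀ k, ∫ x, h k x ∂(volOn Ω) ≤ C) :
    ∃ (σ : ℕ → ℕ) (ν : Measure Ω), StrictMono σ ∧ IsFiniteMeasure ν ∧ ∀ g : C₀(Ω, ℝ),
      Tendsto (fun k => ∫ x, h (σ k) x * g x ∂(volOn Ω)) atTop (𝓝 (∫ x, g x ∂ν)) := by
  let E := closure (Ω : Set (Space n))
  have : CompactSpace E := isCompact_iff_compactSpace.1 hΩ.isCompact_closure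
  let ι : Ω → E := Set.inclusion subset_closure
  have hι : MeasurableEmbedding ι := by
    refine IsOpenEmbedding.measurableEmbedding ⟨IsEmbedding.inclusion _, ?_⟩
    rw [Set.range_inclusion]
    exact Ω.isOpen.preimage continuous_subtype_val
  have hofR : ∀ k, AEMeasurable (fun x => ENNReal.ofReal (h k x)) (volOn Ω) := fun k =>
    (hint k).aestronglyMeasurable.aemeasurable.ennreal_ofReal
  have hmass : ∀ k, (((volOn Ω).withDensity fun x => ENNReal.ofReal (h k x)).map ι) Set.univ
      ≤ ENNReal.ofReal C := by
    intro k
    rw [Measure.map_apply hι.measurable MeasurableSet.univ, Set.preimage_univ,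
      withDensity_apply _ MeasurableSet.univ, Measure.restrict_univ,
      ← ofReal_integral_eq_lintegral_ofReal (hint k) (Eventually.of_forall (h0 k))]
    exact ENNReal.ofReal_le_ofReal (hC k)
  let μ : ℕ → FiniteMeasure E := fun k =>
    ⟨((volOn Ω).withDensity fun x => ENNReal.ofReal (h k x)).map ι,
      ⟨(hmass k).trans_lt ENNReal.ofReal_lt_top⟩⟩
  obtain ⟨σ, ν, hσ, hν⟩ := exists_subseq_tendsto_integral μ (C := C.toNNReal) fun k => by
    rw [← ENNReal.coe_le_coe, FiniteMeasure.ennreal_mass]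
    exact hmass k
  refine ⟨σ, (ν : Measure E).comap ι, hσ, ⟨?_⟩, fun g => ?_⟩
  · rw [hι.comap_apply]
    exact measure_lt_top _ _
  · let G : C(E, ℝ) := ⟨fun x => extendZero g x, (continuous_extendZero g).comp
      continuous_subtype_val⟩
    have hG : ∀ x, G (ι x) = g x := fun x => extendZero_coe g x
    have e1 : ∀ k, ∫ x, G x ∂(μ k : Measure E) = ∫ x, h k x * g x ∂(volOn Ω) := by
      intro k
      change ∫ x, G x ∂(((volOn Ω).withDensity fun x => ENNReal.ofReal (h k x)).map ι) = _
      rw [hι.integral_map, integral_withDensity_eq_integral_toReal_smul₀ (hofR k)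
        (Eventually.of_forall fun x => ENNReal.ofReal_lt_top)]
      refine integral_congr_ae (Eventually.of_forall fun x => ?_)
      simp only [hG, ENNReal.toReal_ofReal (h0 k x), smul_eq_mul]
    have e2 : ∫ x, G x ∂(ν : Measure E) = ∫ x, g x ∂((ν : Measure E).comap ι) := by
      simp_rw [← hG]
      rw [← hι.integral_map (μ := (ν : Measure E).comap ι) G, hι.map_comap,
        setIntegral_eq_integral_of_forall_compl_eq_zero]
      intro x hx
      refine extendZero_of_notMem g fun hxΩ => hx ⟨⟨x, hxΩ⟩, ?_⟩
      rfl
    rw [← e2]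
    exact (hν G).congr fun k => e1 _

/-- The Jordan parts `j⁺`, `j⁻` of `μ - ν` may differ from `μ`, `ν`, but `j⁺ + ν = μ + j⁻` as
measures, and integrating this suffices. -/
theorem signedIntegral_sub {X : Type*} [MeasurableSpace X] {μ ν : Measure X} [IsFiniteMeasure μ]
    [IsFiniteMeasure ν] {g : X → ℝ} {C : ℝ} (hg : Measurable g) (hC : ∀ x, ‖g x‖ ≤ C) :
    signedIntegral (μ.toSignedMeasure - ν.toSignedMeasure) g = ∫ x, g x ∂μ - ∫ x, g x ∂ν := by
  set s := μ.toSignedMeasure - ν.toSignedMeasure with hs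
  set j := s.toJordanDecomposition with hj
  have hI : ∀ (ρ : Measure X) [IsFiniteMeasure ρ], Integrable g ρ := fun ρ _ =>
    Integrable.of_bound hg.aestronglyMeasurable C (Eventually.of_forall hC)
  have h1 : j.posPart.toSignedMeasure - j.negPart.toSignedMeasure = s :=
    s.toSignedMeasure_toJordanDecomposition
  have h2 : j.posPart + ν = μ + j.negPart := by
    rw [← Measure.toSignedMeasure_eq_toSignedMeasure_iff, Measure.toSignedMeasure_add,
      Measure.toSignedMeasure_add]
    rw [hs, sub_eq_sub_iff_add_eq_add] at h1
    exact h1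
  have h3 := congrArg (fun ρ : Measure X => ∫ x, g x ∂ρ) h2
  simp only [integral_add_measure (hI _) (hI _)] at h3
  unfold signedIntegral
  linarith

/-- Sequences bounded in `L¹(Ω)` have subsequences converging weakly-* in the sense of measures. -/
theorem exists_subseq_signedMeasure (hΩ : Bornology.IsBounded (Ω : Set (Space n)))
    {h : ℕ → Ω → ℝ} (hint : ∀ k, Integrable (h k) (volOn Ω)) {C : ℝ}
    (hC : ∀ k, ∫ x, |h k x| ∂(volOn Ω) ≤ C) :
    ∃ (σ : ℕ → ℕ) (m : SignedMeasure Ω), StrictMono σ ∧ ∀ g : C₀(Ω, ℝ),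
      Tendsto (fun k => ∫ x, h (σ k) x * g x ∂(volOn Ω)) atTop (𝓝 (signedIntegral m g)) := by
  obtain ⟨σ, μ, hσ, hμf, hμ⟩ := exists_subseq_density hΩ (h := fun k x => max (h k x) 0)
    (fun k => (hint k).pos_part) (fun k x => le_max_right _ _) (C := C) fun k =>
      (integral_mono (hint k).pos_part (hint k).abs fun x =>
        max_le (le_abs_self _) (abs_nonneg _)).trans (hC k)
  obtain ⟨τ, ν, hτ, hνf, hν⟩ := exists_subseq_density hΩ (h := fun k x => max (-h (σ k) x) 0)
    (fun k => (hint _).neg_part) (fun k x => le_max_right _ _) (C := C) fun k =>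
      (integral_mono (hint _).neg_part (hint _).abs fun x =>
        max_le (neg_le_abs _) (abs_nonneg _)).trans (hC _)
  refine ⟨σ ∘ τ, μ.toSignedMeasure - ν.toSignedMeasure, hσ.comp hτ, fun g => ?_⟩
  have hgb : ∀ x, ‖g x‖ ≤ ‖g.toBCF‖ := fun x => g.toBCF.norm_coe_le_norm x
  rw [signedIntegral_sub (g := g) (map_continuous g).measurable hgb]
  refine (((hμ g).comp hτ.tendsto_atTop).sub (hν g)).congr fun k => ?_
  have hI : ∀ f : Ω → ℝ, Integrable f (volOn Ω) → Integrable (fun x => f x * g x) (volOn Ω) :=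
    fun f hf => hf.mul_bdd (c := ‖g.toBCF‖) g.continuous.aestronglyMeasurable
      (Eventually.of_forall hgb)
  simp only [Function.comp_apply]
  rw [← integral_sub (hI _ (hint _).pos_part) (hI _ (hint _).neg_part)]
  refine integral_congr_ae (Eventually.of_forall fun x => ?_)
  simp only
  rw [← sub_mul, max_zero_sub_max_neg_zero_eq_self]

/-! ### Green's formula and compactness of the controls -/

/-- Green's formula for functions in `H²(Ω) ∩ H₀¹(Ω)`. -/
theorem sum_inner_grad (φ : H2H10 Ω) (v : H10 Ω) :
    ∑ i, inner ℝ (grad (toH10 φ) i) (grad v i) = -inner ℝ (lap φ) (fn v) := by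
  obtain ⟨hd, hd0⟩ := tendsto_one_div_succ_pos
  choose ψ w hw hclose using fun k => exists_test_near v (hd k)
  have hwv : Tendsto w atTop (𝓝 v) := by
    rw [tendsto_iff_norm_sub_tendsto_zero]
    exact squeeze_zero (fun _ => norm_nonneg _) (fun k => (hclose k).le) hd0
  have h1 : Tendsto (fun k => ∑ i, inner ℝ (grad (toH10 φ) i) (grad (w k) i)) atTop
      (𝓝 (∑ i, inner ℝ (grad (toH10 φ) i) (grad v i))) :=
    tendsto_finsetSum _ fun i _ =>
      tendsto_const_nhds.inner (((gradL Ω i).continuous.tendsto v).comp hwv)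
  have h2 : Tendsto (fun k => -inner ℝ (lap φ) (fn (w k))) atTop
      (𝓝 (-inner ℝ (lap φ) (fn v))) :=
    (tendsto_const_nhds.inner (((fnL Ω).continuous.tendsto v).comp hwv)).neg
  refine tendsto_nhds_unique h1 (h2.congr fun k => ?_)
  rw [lap, sum_inner, ← Finset.sum_neg_distrib]
  refine Finset.sum_congr rfl fun i _ => ?_
  have h := φ.2 i i (ψ k)
  rw [← integral_mul_eq_inner, ← integral_mul_eq_inner]
  have e1 : ∫ x in (Ω : Set (Space n)), grad (toH10 φ) i x * grad (w k) i x
      = ∫ x in (Ω : Set (Space n)), grad (toH10 φ) i x * partialDeriv i (ψ k) x := by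
    refine integral_congr_ae ?_
    filter_upwards [(hw k).2 i] with x hx
    rw [hx]
  rw [e1]
  refine Eq.trans ?_ h.symm
  rw [neg_inj]
  refine integral_congr_ae ?_
  filter_upwards [(hw k).1] with x hx
  rw [hx]

/-- Green's formula with `v = φ`: bounds on `φ` and `Δφ` in `L²` bound `φ` in `H¹`. -/
theorem norm_sq_toH10 (φ : H2H10 Ω) :
    ‖toH10 φ‖ ^ 2 = ‖fn (toH10 φ)‖ ^ 2 - inner ℝ (lap φ) (fn (toH10 φ)) := by
  rw [norm_sq_eq, sub_eq_add_neg, ← sum_inner_grad]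
  simp_rw [real_inner_self_eq_norm_sq]

theorem lap_add (φ χ : H2H10 Ω) : lap (φ + χ) = lap φ + lap χ :=
  Finset.sum_add_distrib

theorem lap_smul (c : ℝ) (φ : H2H10 Ω) : lap (c • φ) = c • lap φ :=
  (Finset.smul_sum (r := c)).symm

/-- The linear map `φ ↦ (φ, Δφ)`. -/
def graphMap (Ω : Opens (Space n)) : H2H10 Ω →ₗ[ℝ] H10 Ω × L2 Ω where
  toFun φ := (toH10 φ, lap φ)
  map_add' φ χ := Prod.ext rfl (lap_add φ χ)
  map_smul' c φ := Prod.ext rfl (lap_smul c φ)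

/-- Strong convergence in `H₀¹(Ω)` of controls whose Laplacians are bounded. -/
theorem tendsto_toH10 (hΩ : Bornology.IsBounded (Ω : Set (Space n))) {φ : ℕ → H2H10 Ω}
    {φ₀ : H10 Ω} {l : L2 Ω} {C : ℝ} (hC : ∀ k, ‖toH10 (φ k)‖ ≤ C) (hl : ∀ k, ‖lap (φ k)‖ ≤ C)
    (h₁ : WeakTendsto (fun k => toH10 (φ k)) φ₀) (h₂ : WeakTendsto (fun k => lap (φ k)) l) :
    Tendsto (fun k => toH10 (φ k)) atTop (𝓝 φ₀) := by
  -- Green's formula survives for the weak limit pair `(φ₀, l)`, although `φ₀` is not known to be in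
  -- `H²`.
  have hgreen : ∀ v : H10 Ω, ∑ i, inner ℝ (grad φ₀ i) (grad v i) = -inner ℝ l (fn v) := by
    intro v
    have e1 : Tendsto (fun k => ∑ i, inner ℝ (grad (toH10 (φ k)) i) (grad v i)) atTop
        (𝓝 (∑ i, inner ℝ (grad φ₀ i) (grad v i))) :=
      tendsto_finsetSum _ fun i _ => by
        simp_rw [real_inner_comm (grad v i)]
        exact h₁ ((innerSL ℝ (grad v i)).comp (gradL Ω i))
    have e2 : Tendsto (fun k => -inner ℝ (lap (φ k)) (fn v)) atTop (𝓝 (-inner ℝ l (fn v))) := by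
      simp_rw [real_inner_comm (fn v)]
      exact (h₂ (innerSL ℝ (fn v))).neg
    exact tendsto_nhds_unique e1 (e2.congr fun k => (sum_inner_grad (φ k) v).symm)
  have hfn := tendsto_iff_norm_sub_tendsto_zero.1 (h₁.tendsto_fn hΩ hC)
  rw [tendsto_iff_norm_sub_tendsto_zero]
  have hlim : Tendsto (fun k => ‖fn (toH10 (φ k)) - fn φ₀‖ ^ 2
      + (C + ‖l‖) * ‖fn (toH10 (φ k)) - fn φ₀‖) atTop (𝓝 0) := by
    simpa using (hfn.pow 2).add (hfn.const_mul (C + ‖l‖))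
  have hle : ∀ k, ‖toH10 (φ k) - φ₀‖ ^ 2 ≤ ‖fn (toH10 (φ k)) - fn φ₀‖ ^ 2
      + (C + ‖l‖) * ‖fn (toH10 (φ k)) - fn φ₀‖ := by
    intro k
    -- Green's formula for the difference trades its gradient for a bounded Laplacian times an `L²`
    -- norm that tends to zero by Rellich.
    have e : ∑ i, ‖grad (toH10 (φ k) - φ₀) i‖ ^ 2
        = -inner ℝ (lap (φ k) - l) (fn (toH10 (φ k) - φ₀)) := by
      have e1 := sum_inner_grad (φ k) (toH10 (φ k) - φ₀)
      have e2 := hgreen (toH10 (φ k) - φ₀)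
      rw [inner_sub_left, neg_sub', ← e1, ← e2, ← Finset.sum_sub_distrib]
      refine Finset.sum_congr rfl fun i _ => ?_
      rw [← inner_sub_left, ← grad_sub, real_inner_self_eq_norm_sq]
    rw [norm_sq_eq, e, fn_sub]
    gcongr
    refine (neg_le_abs _).trans ((abs_real_inner_le_norm _ _).trans ?_)
    gcongr
    exact (norm_sub_le _ _).trans (by gcongr; exact hl k)
  simpa [Real.sqrt_sq] using (squeeze_zero (fun k => sq_nonneg _) hle hlim).sqrt

/-! ### Optimality and uniform bounds -/

/-- Weak limits of sequences in a convex set are strong limits of sequences in that set. -/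
theorem mem_closure_of_weak {H : Type*} [NormedAddCommGroup H] [NormedSpace ℝ H] {s : Set H}
    (hs : Convex ℝ s) {u : ℕ → H} {u₀ : H} (hu : ∀ k, u k ∈ s) (h : WeakTendsto u u₀) :
    u₀ ∈ closure s := by
  by_contra hn
  obtain ⟨ℓ, c, h1, h2⟩ := geometric_hahn_banach_point_closed hs.closure isClosed_closure hn
  exact absurd (ge_of_tendsto' (h ℓ) fun k => (h2 _ (subset_closure (hu k))).le) h1.not_ge

theorem WeakTendsto.prodMk {H H' : Type*} [NormedAddCommGroup H] [NormedSpace ℝ H]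
    [NormedAddCommGroup H'] [NormedSpace ℝ H'] {u : ℕ → H} {u₀ : H} {v : ℕ → H'} {v₀ : H'}
    (hu : WeakTendsto u u₀) (hv : WeakTendsto v v₀) :
    WeakTendsto (fun k => (u k, v k)) (u₀, v₀) := by
  intro ℓ
  have e : ∀ a b, ℓ (a, b) = ℓ.comp (ContinuousLinearMap.inl ℝ H H') a
      + ℓ.comp (ContinuousLinearMap.inr ℝ H H') b := fun a b => by
    simp [← map_add]
  simp_rw [e]
  exact (hu _).add (hv _)

/-- The cost at a weak limit of admissible controls is at least the optimal cost. -/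
theorem IsOptimal.cost_le_of_weak (hΩ : Bornology.IsBounded (Ω : Set (Space n))) {K : Coeffs n}
    (hK : K.Admissible Ω) {f z : L2 Ω} {ν : ℝ} {Uad : Set (H2H10 Ω)} (hU : Convex ℝ Uad)
    {φstar : H2H10 Ω} {ystar : H10 Ω} (hstar : IsOptimal K f z ν Uad φstar ystar)
    {φ : ℕ → H2H10 Ω} (hφ : ∀ k, φ k ∈ Uad) {φ₀ y₀ : H10 Ω} {l : L2 Ω}
    (h₁ : WeakTendsto (fun k => toH10 (φ k)) φ₀) (h₂ : WeakTendsto (fun k => lap (φ k)) l)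
    (hy : IsObstacleState K f φ₀ y₀) :
    cost z ν φstar ystar ≤ 1 / 2 * ‖fn y₀ - z‖ ^ 2 + ν / 2 * ‖l‖ ^ 2 := by
  -- Mazur: although `(φ₀, l)` need not come from `Uad`, it is a strong limit of pairs `(ψ, Δψ)`
  -- with `ψ ∈ Uad`, and the cost is continuous in this topology.
  have hmem : (φ₀, l) ∈ closure (graphMap Ω '' Uad) :=
    mem_closure_of_weak (hU.linear_image (graphMap Ω)) (u := fun k => graphMap Ω (φ k))
      (fun k => ⟨φ k, hφ k, rfl⟩) (h₁.prodMk h₂)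
  obtain ⟨x, hx, hlim⟩ := mem_closure_iff_seq_limit.1 hmem
  choose ψ hψ hψx using hx
  choose w hw using fun k => exists_isObstacleState hΩ hK f (toH10 (ψ k))
  have e1 : Tendsto (fun k => toH10 (ψ k)) atTop (𝓝 φ₀) :=
    ((continuous_fst.tendsto _).comp hlim).congr fun k => by
      rw [Function.comp_apply, ← hψx]; rfl
  have e2 : Tendsto (fun k => lap (ψ k)) atTop (𝓝 l) :=
    ((continuous_snd.tendsto _).comp hlim).congr fun k => by
      rw [Function.comp_apply, ← hψx]; rfl
  obtain ⟨C, hC⟩ := exists_obstacleState_lipschitz hK f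
  have e3 : Tendsto w atTop (𝓝 y₀) := by
    rw [tendsto_iff_norm_sub_tendsto_zero]
    refine squeeze_zero (fun _ => norm_nonneg _) (fun k => hC _ _ _ _ (hw k) hy) ?_
    simpa using (tendsto_iff_norm_sub_tendsto_zero.1 e1).const_mul C
  have e4 : Tendsto (fun k => fn (w k)) atTop (𝓝 (fn y₀)) :=
    ((fnL Ω).continuous.tendsto y₀).comp e3
  refine ge_of_tendsto' ((((e4.sub_const z).norm.pow 2).const_mul (1 / 2)).add
    ((e2.norm.pow 2).const_mul (ν / 2))) fun k => hstar.2.2 _ (hψ k) _ (hw k)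

theorem integral_multiplier_mul_nonneg {δ : ℝ} (hδ : 0 < δ) (φ y p : H10 Ω) :
    0 ≤ ∫ x in (Ω : Set (Space n)), multiplier δ φ y p x * fn p x := by
  refine integral_nonneg fun x => ?_
  change 0 ≤ betaDeriv δ _ * fn p x * fn p x
  rw [mul_assoc]
  exact mul_nonneg (betaDeriv_nonneg hδ _) (mul_self_nonneg _)

/-- Uniform bounds for the solutions of the penalized problems. -/
theorem exists_uniform_bounds {K : Coeffs n} (hK : K.Admissible Ω) {f z : L2 Ω} {ν : ℝ}
    (hν : 0 < ν) {Uad : Set (H2H10 Ω)} {φstar : H2H10 Ω} (hmem : φstar ∈ Uad)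
    {φ : ℝ → H2H10 Ω} {y p : ℝ → H10 Ω}
    (hopt : ∀ δ > 0, IsPenalizedOptimal K f z ν Uad φstar δ (φ δ) (y δ))
    (hadj : ∀ δ > 0, IsAdjointState K z δ (toH10 (φ δ)) (y δ) (p δ)) :
    ∃ C, ∀ δ > 0, ‖toH10 (φ δ)‖ ≤ C ∧ ‖lap (φ δ)‖ ≤ C ∧ ‖y δ‖ ≤ C ∧ ‖p δ‖ ≤ C := by
  obtain ⟨C₀, hC₀⟩ := exists_norm_penalizedState_le hK f ‖toH10 φstar‖
  set D := (C₀ + ‖z‖) ^ 2 + ν * ‖lap φstar‖ ^ 2 with hD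
  have hD0 : 0 ≤ D := by positivity
  have hcost : ∀ δ > 0, ν * ‖lap (φ δ)‖ ^ 2
      + ‖fn (toH10 (φ δ)) - fn (toH10 φstar)‖ ^ 2 ≤ D := by
    intro δ hδ
    -- Comparison with `φ*`, whose distance term vanishes and whose penalized state is bounded
    -- uniformly in `δ`.
    obtain ⟨w, hw⟩ := exists_isPenalizedState hK f hδ (toH10 φstar)
    have h1 := (hopt δ hδ).2.2 φstar hmem w hw
    unfold penalizedCost at h1
    rw [sub_self, norm_zero] at h1
    have h2 : ‖fn w - z‖ ^ 2 ≤ (C₀ + ‖z‖) ^ 2 := by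
      refine pow_le_pow_left₀ (norm_nonneg _) ((norm_sub_le _ _).trans ?_) 2
      gcongr
      exact (norm_fn_le w).trans (hC₀ δ hδ _ _ le_rfl hw)
    have h3 := sq_nonneg ‖fn (y δ) - z‖
    rw [hD]
    linarith
  set C₁ := √(D / ν) with hC₁
  set C₂ := √D + ‖fn (toH10 φstar)‖ with hC₂
  have hlap : ∀ δ > 0, ‖lap (φ δ)‖ ≤ C₁ := fun δ hδ => Real.le_sqrt_of_sq_le <| by
    rw [le_div_iff₀ hν]
    linarith [hcost δ hδ, sq_nonneg ‖fn (toH10 (φ δ)) - fn (toH10 φstar)‖]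
  have hfn : ∀ δ > 0, ‖fn (toH10 (φ δ))‖ ≤ C₂ := fun δ hδ => by
    have h1 : ‖fn (toH10 (φ δ)) - fn (toH10 φstar)‖ ≤ √D := Real.le_sqrt_of_sq_le <| by
      have : 0 ≤ ν * ‖lap (φ δ)‖ ^ 2 := by positivity
      linarith [hcost δ hδ]
    have h2 := norm_le_insert' (fn (toH10 (φ δ))) (fn (toH10 φstar))
    linarith
  set C₃ := √(C₂ ^ 2 + C₁ * C₂) with hC₃
  have hH : ∀ δ > 0, ‖toH10 (φ δ)‖ ≤ C₃ := fun δ hδ => Real.le_sqrt_of_sq_le <| by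
    rw [norm_sq_toH10, sub_eq_add_neg]
    have h1 := hlap δ hδ
    have h2 := hfn δ hδ
    refine add_le_add (pow_le_pow_left₀ (norm_nonneg _) h2 2)
      ((neg_le_abs _).trans ((abs_real_inner_le_norm _ _).trans ?_))
    gcongr
  obtain ⟨C₄, hC₄⟩ := exists_norm_penalizedState_le hK f C₃
  have hy : ∀ δ > 0, ‖y δ‖ ≤ C₄ := fun δ hδ => hC₄ δ hδ _ _ (hH δ hδ) (hopt δ hδ).2.1
  obtain ⟨m, hm, hcoer⟩ := hK.coercive
  have hp : ∀ δ > 0, ‖p δ‖ ≤ (C₄ + ‖z‖) / m := by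
    intro δ hδ
    -- Testing the adjoint equation with `p^δ` itself, the penalty term is nonnegative and drops
    -- out.
    have h1 := hadj δ hδ (p δ)
    have h2 := hcoer (p δ)
    have h3 := integral_multiplier_mul_nonneg hδ (toH10 (φ δ)) (y δ) (p δ)
    have h4 : inner ℝ (fn (y δ) - z) (fn (p δ)) ≤ (C₄ + ‖z‖) * ‖p δ‖ := by
      refine (real_inner_le_norm _ _).trans ?_
      have h5 := norm_fn_le (p δ)
      have h6 : ‖fn (y δ) - z‖ ≤ C₄ + ‖z‖ :=
        (norm_sub_le _ _).trans (by gcongr; exact (norm_fn_le _).trans (hy δ hδ))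
      exact mul_le_mul h6 h5 (norm_nonneg _) ((norm_nonneg _).trans h6)
    have h7 : adjForm K (p δ) (p δ) = form K (p δ) (p δ) := rfl
    rw [le_div_iff₀ hm]
    rcases (norm_nonneg (p δ)).eq_or_lt with h0 | h0
    · rw [← h0, zero_mul]
      have := (norm_nonneg _).trans (hy δ hδ)
      positivity
    · refine le_of_mul_le_mul_right ?_ h0
      linarith
  refine ⟨max (max C₁ C₃) (max C₄ ((C₄ + ‖z‖) / m)), fun δ hδ => ⟨?_, ?_, ?_, ?_⟩⟩
  · exact (hH δ hδ).trans ((le_max_right _ _).trans (le_max_left _ _))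
  · exact (hlap δ hδ).trans ((le_max_left _ _).trans (le_max_left _ _))
  · exact (hy δ hδ).trans ((le_max_left _ _).trans (le_max_right _ _))
  · exact (hp δ hδ).trans ((le_max_right _ _).trans (le_max_right _ _))

/-- Weak limits of optimal states of the penalized problems are the optimal state. -/
theorem IsOptimal.eq_of_weak (hΩ : Bornology.IsBounded (Ω : Set (Space n))) {K : Coeffs n}
    (hK : K.Admissible Ω) {f z : L2 Ω} {ν : ℝ} (hν : 0 < ν) {Uad : Set (H2H10 Ω)}
    (hU : Convex ℝ Uad) {φstar : H2H10 Ω} {ystar : H10 Ω}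
    (hstar : IsOptimal K f z ν Uad φstar ystar) {d : ℕ → ℝ} (hd : ∀ k, 0 < d k)
    (hd0 : Tendsto d atTop (𝓝 0)) {φ : ℕ → H2H10 Ω} {y w : ℕ → H10 Ω}
    (hopt : ∀ k, IsPenalizedOptimal K f z ν Uad φstar (d k) (φ k) (y k))
    (hw : ∀ k, IsPenalizedState K f (d k) (toH10 φstar) (w k)) {C : ℝ}
    (hφC : ∀ k, ‖toH10 (φ k)‖ ≤ C) (hlC : ∀ k, ‖lap (φ k)‖ ≤ C) (hyC : ∀ k, ‖y k‖ ≤ C)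
    (hwC : ∀ k, ‖w k‖ ≤ C) {φ₀ y₀ w₀ : H10 Ω} {l : L2 Ω}
    (hφ : WeakTendsto (fun k => toH10 (φ k)) φ₀) (hl : WeakTendsto (fun k => lap (φ k)) l)
    (hy : WeakTendsto y y₀) (hww : WeakTendsto w w₀) : y₀ = ystar := by
  have hφs := tendsto_toH10 hΩ hφC hlC hφ hl
  have hφfn := hφ.tendsto_fn hΩ hφC
  have hyfn := hy.tendsto_fn hΩ hyC
  have hwfn := hww.tendsto_fn hΩ hwC
  have hy₀ := isObstacleState_of_tendsto hK hd hd0 hφs (fun k => (hopt k).2.1) hyC hy hyfn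
  have hw₀ := isObstacleState_of_tendsto hK hd hd0 tendsto_const_nhds hw hwC hww hwfn
  have hwstar : w₀ = ystar := IsObstacleState.unique hK rfl hw₀ hstar.2.1
  rw [hwstar] at hwfn
  have hlow := hstar.cost_le_of_weak hΩ hK hU (fun k => (hopt k).1) hφ hl hy₀
  -- Weak lower semicontinuity of `‖Δφ‖²` in `J_δ(φ^δ) ≤ J_δ(φ*)`; every other term converges
  -- strongly. Against `hlow` only `‖φ₀ - φ*‖² ≤ 0` is left.
  have hup : ‖l‖ ^ 2 ≤ (‖fn ystar - z‖ ^ 2 + ν * ‖lap φstar‖ ^ 2 - ‖fn y₀ - z‖ ^ 2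
      - ‖fn φ₀ - fn (toH10 φstar)‖ ^ 2) / ν := by
    refine hl.norm_sq_le_of_tendsto (((((hwfn.sub_const z).norm.pow 2).add_const
      (ν * ‖lap φstar‖ ^ 2)).sub ((hyfn.sub_const z).norm.pow 2)).sub
      ((hφfn.sub_const (fn (toH10 φstar))).norm.pow 2) |>.div_const ν) fun k => ?_
    have h := (hopt k).2.2 φstar hstar.1 (w k) (hw k)
    unfold penalizedCost at h
    rw [sub_self (fn (toH10 φstar)), norm_zero] at h
    rw [le_div_iff₀ hν]
    linarith
  rw [le_div_iff₀ hν] at hup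
  unfold cost at hlow
  have h0 : ‖fn φ₀ - fn (toH10 φstar)‖ ^ 2 ≤ 0 := by linarith
  have hfn : fn φ₀ = fn (toH10 φstar) := by
    rw [← sub_eq_zero, ← norm_eq_zero]
    exact pow_eq_zero_iff (two_ne_zero) |>.1 (le_antisymm h0 (sq_nonneg _))
  exact IsObstacleState.unique hK hfn hy₀ hstar.2.1

end ObstacleControl

end

/-! ### Passage to the limit in the adjoint equation -/

open ObstacleControl in
theorem mainTheorem7 {n : ℕ} (hn : 1 ≤ n)
    (Ω : Opens (Space n)) (hΩ : Bornology.IsBounded (Ω : Set (Space n)))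
    (K : Coeffs n) (hK : K.Admissible Ω)
    (f z : L2 Ω) (ν : ℝ) (hν : 0 < ν)
    (Uad : Set (H2H10 Ω)) (hUclosed : IsClosed Uad) (hUconvex : Convex ℝ Uad)
    -- an optimal pair of the obstacle control problem
    (φstar : H2H10 Ω) (ystar : H10 Ω) (hstar : IsOptimal K f z ν Uad φstar ystar)
    -- optimal pairs of the penalized problems, and the corresponding adjoint states
    (φ : ℝ → H2H10 Ω) (y p : ℝ → H10 Ω)
    (hopt : ∀ δ > 0, IsPenalizedOptimal K f z ν Uad φstar δ (φ δ) (y δ))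
    (hadj : ∀ δ > 0, IsAdjointState K z δ (toH10 (φ δ)) (y δ) (p δ)) :
    -- the multipliers are bounded in `L¹(Ω)`
    (∃ C : ℝ, ∀ δ > 0,
      IntegrableOn (multiplier δ (toH10 (φ δ)) (y δ) (p δ)) (Ω : Set (Space n)) ∧
      ∫ x in (Ω : Set (Space n)), |multiplier δ (toH10 (φ δ)) (y δ) (p δ) x| ≤ C) ∧
    -- every sequence `δ → 0⁺` has a subsequence `s` along which everything converges
    (∀ d : ℕ → ℝ, (∀ k, 0 < d k) → Tendsto d atTop (𝓝 0) →
      ∃ σ : ℕ → ℕ, StrictMono σ ∧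
      ∃ (pstar : H10 Ω) (μstar : HNeg1 Ω) (m : SignedMeasure Ω),
        -- `p^δ ⇀ p*` weakly in `H₀¹(Ω)`
        (∀ ℓ : StrongDual ℝ (H10 Ω),
          Tendsto (fun k => ℓ (p (d (σ k)))) atTop (𝓝 (ℓ pstar))) ∧
        -- `μ* ∈ H⁻¹(Ω) ∩ ℳ(Ω)`
        IsRepresentedBy μstar m ∧
        -- `μ^δ ⇀ μ*` weakly-* in `H⁻¹(Ω)`
        (∀ w : H10 Ω,
          Tendsto (fun k => ∫ x in (Ω : Set (Space n)),
              multiplier (d (σ k)) (toH10 (φ (d (σ k)))) (y (d (σ k))) (p (d (σ k))) x * fn w x)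
            atTop (𝓝 (μstar w))) ∧
        -- `μ^δ ⇀ μ*` weakly-* in `ℳ(Ω) = C₀(Ω)'`
        (∀ g : C₀(Ω, ℝ),
          Tendsto (fun k => ∫ x : Ω,
              multiplier (d (σ k)) (toH10 (φ (d (σ k)))) (y (d (σ k))) (p (d (σ k)))
                (x : Space n) * g x ∂(volOn Ω))
            atTop (𝓝 (signedIntegral m g))) ∧
        -- `A* p* + μ* = y* - z` in `H⁻¹(Ω)`
        (∀ w : H10 Ω, adjForm K pstar w + μstar w = inner ℝ (fn ystar - z) (fn w)) ∧
        -- `⟨μ*, p*⟩ ≥ 0`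
        0 ≤ μstar pstar) := by
  obtain ⟨A, hA⟩ := exists_form_bilin hK
  obtain ⟨m₀, hm₀, hcoer⟩ := hK.coercive
  obtain ⟨C, hC⟩ := exists_uniform_bounds hK hν hstar.1 hopt hadj
  obtain ⟨C', hC'⟩ := exists_norm_penalizedState_le hK f ‖toH10 φstar‖
  set B := (C + ‖z‖) * (2 * √(volume.real (Ω : Set (Space n)))) with hB
  have hL1 : ∀ δ > 0, ∫ x in (Ω : Set (Space n)),
      |multiplier δ (toH10 (φ δ)) (y δ) (p δ) x| ≤ B := fun δ hδ => by
    refine ((hadj δ hδ).integral_abs_multiplier_le hK hΩ hδ).trans ?_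
    rw [hB]
    gcongr
    exact (norm_sub_le _ _).trans (by gcongr; exact (norm_fn_le _).trans (hC δ hδ).2.2.1)
  refine ⟨⟨B, fun δ hδ => ⟨integrable_multiplier hΩ hδ _ _ _, hL1 δ hδ⟩⟩, fun d hd hd0 => ?_⟩
  have hmeas : MeasurableSet (Ω : Set (Space n)) := Ω.isOpen.measurableSet
  have hemb : MeasurableEmbedding (Subtype.val : Ω → Space n) :=
    MeasurableEmbedding.subtype_coe hmeas
  have hmap : (volOn Ω).map Subtype.val = volume.restrict (Ω : Set (Space n)) :=
    map_comap_subtype_coe hmeas volume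
  have hvol : ∀ h : Space n → ℝ, ∫ x : Ω, h x ∂(volOn Ω) = ∫ x in (Ω : Set (Space n)), h x :=
    fun h => integral_subtype_comap hmeas h
  -- Penalized states of the fixed control `φ*`: they are the comparison states in `J_δ(φ^δ) ≤
  -- J_δ(φ*)` and converge to `y*`.
  choose w hw using fun k => exists_isPenalizedState hK f (hd k) (toH10 φstar)
  have hwC : ∀ k, ‖w k‖ ≤ C' := fun k => hC' _ (hd k) _ _ le_rfl (hw k)
  obtain ⟨σ₁, φ₀, hσ₁, h₁⟩ := exists_weakTendsto_subseq (u := fun k => toH10 (φ (d k)))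
    fun k => (hC _ (hd k)).1
  obtain ⟨σ₂, l, hσ₂, h₂⟩ := exists_weakTendsto_subseq (u := fun k => lap (φ (d (σ₁ k))))
    fun k => (hC _ (hd _)).2.1
  obtain ⟨σ₃, y₀, hσ₃, h₃⟩ := exists_weakTendsto_subseq (u := fun k => y (d (σ₁ (σ₂ k))))
    fun k => (hC _ (hd _)).2.2.1
  obtain ⟨σ₄, w₀, hσ₄, h₄⟩ := exists_weakTendsto_subseq (u := fun k => w (σ₁ (σ₂ (σ₃ k))))
    fun k => hwC _
  obtain ⟨σ₅, pstar, hσ₅, h₅⟩ := exists_weakTendsto_subseq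
    (u := fun k => p (d (σ₁ (σ₂ (σ₃ (σ₄ k)))))) fun k => (hC _ (hd _)).2.2.2
  obtain ⟨σ₆, m, hσ₆, h₆⟩ := exists_subseq_signedMeasure hΩ
    (h := fun k (x : Ω) => multiplier (d (σ₁ (σ₂ (σ₃ (σ₄ (σ₅ k))))))
      (toH10 (φ (d (σ₁ (σ₂ (σ₃ (σ₄ (σ₅ k)))))))) (y (d (σ₁ (σ₂ (σ₃ (σ₄ (σ₅ k)))))))
      (p (d (σ₁ (σ₂ (σ₃ (σ₄ (σ₅ k))))))) x) (C := B)
    (fun k => by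
      have := integrable_multiplier hΩ (hd (σ₁ (σ₂ (σ₃ (σ₄ (σ₅ k))))))
        (toH10 (φ (d (σ₁ (σ₂ (σ₃ (σ₄ (σ₅ k)))))))) (y (d (σ₁ (σ₂ (σ₃ (σ₄ (σ₅ k)))))))
        (p (d (σ₁ (σ₂ (σ₃ (σ₄ (σ₅ k)))))))
      rw [← hmap, hemb.integrable_map_iff] at this
      exact this)
    (fun k => by
      rw [hvol fun x => |multiplier _ _ _ _ x|]
      exact hL1 _ (hd _))
  have hσ₅₆ := hσ₅.comp hσ₆
  have hσ₄₆ := hσ₄.comp hσ₅₆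
  have hσ₃₆ := hσ₃.comp hσ₄₆
  have hσ₂₆ := hσ₂.comp hσ₃₆
  set σ : ℕ → ℕ := σ₁ ∘ σ₂ ∘ σ₃ ∘ σ₄ ∘ σ₅ ∘ σ₆
  have hσ : StrictMono σ := hσ₁.comp hσ₂₆
  have hφw : WeakTendsto (fun k => toH10 (φ (d (σ k)))) φ₀ := h₁.comp hσ₂₆
  have hlw : WeakTendsto (fun k => lap (φ (d (σ k)))) l := h₂.comp hσ₃₆
  have hyw : WeakTendsto (fun k => y (d (σ k))) y₀ := h₃.comp hσ₄₆
  have hww : WeakTendsto (fun k => w (σ k)) w₀ := h₄.comp hσ₅₆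
  have hpw : WeakTendsto (fun k => p (d (σ k))) pstar := h₅.comp hσ₆
  have hystar : y₀ = ystar :=
    hstar.eq_of_weak hΩ hK hν hUconvex (fun k => hd (σ k)) (hd0.comp hσ.tendsto_atTop)
      (fun k => hopt _ (hd (σ k))) (fun k => hw (σ k)) (C := max C C')
      (fun k => (hC _ (hd _)).1.trans (le_max_left _ _))
      (fun k => (hC _ (hd _)).2.1.trans (le_max_left _ _))
      (fun k => (hC _ (hd _)).2.2.1.trans (le_max_left _ _))
      (fun k => (hwC _).trans (le_max_right _ _)) hφw hlw hyw hww
  have hyfn : Tendsto (fun k => fn (y (d (σ k)))) atTop (𝓝 (fn ystar)) :=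
    hystar ▸ hyw.tendsto_fn hΩ fun k => (hC _ (hd _)).2.2.1
  have hpfn : Tendsto (fun k => fn (p (d (σ k)))) atTop (𝓝 (fn pstar)) :=
    hpw.tendsto_fn hΩ fun k => (hC _ (hd _)).2.2.2
  have hadjA : ∀ k v, ∫ x in (Ω : Set (Space n)),
      multiplier (d (σ k)) (toH10 (φ (d (σ k)))) (y (d (σ k))) (p (d (σ k))) x * fn v x
      = inner ℝ (fn (y (d (σ k))) - z) (fn v) - A v (p (d (σ k))) := by
    intro k v
    have := hadj _ (hd (σ k)) v
    rw [adjForm, ← hA] at this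
    linarith
  -- The limit is defined by the limit equation, as `y* - z - A*p*`.
  let μstar : HNeg1 Ω := (innerSL ℝ (fn ystar - z)).comp (fnL Ω) - A.flip pstar
  have hμstar : ∀ v, μstar v = inner ℝ (fn ystar - z) (fn v) - A v pstar := fun v => rfl
  have hμlim : ∀ v : H10 Ω, Tendsto (fun k => ∫ x in (Ω : Set (Space n)),
      multiplier (d (σ k)) (toH10 (φ (d (σ k)))) (y (d (σ k))) (p (d (σ k))) x * fn v x)
      atTop (𝓝 (μstar v)) := by
    intro v
    simp_rw [hadjA, hμstar]
    exact ((hyfn.sub_const z).inner tendsto_const_nhds).sub (hpw (A v))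
  refine ⟨σ, hσ, pstar, μstar, m, hpw, ?_, hμlim, h₆, ?_, ?_⟩
  · intro v g hvg
    refine tendsto_nhds_unique (hμlim v) ((h₆ g).congr fun k => ?_)
    rw [← hvol fun x => multiplier _ _ _ _ x * fn v x]
    refine integral_congr_ae ?_
    filter_upwards [hvg] with x hx
    rw [← hx]
    rfl
  · intro v
    rw [hμstar, adjForm, ← hA]
    ring
  -- Since `∫ μ^δ p^δ ≥ 0`, `a(p^δ, p^δ) ≤ (y^δ - z, p^δ)`. The left side is weakly lower
  -- semicontinuous, and the right side converges because both factors converge strongly in `L²`.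
  · have hle : A pstar pstar ≤ inner ℝ (fn ystar - z) (fn pstar) := by
      refine hpw.le_of_tendsto A (fun v => by
        rw [hA]; exact (mul_nonneg hm₀.le (sq_nonneg _)).trans (hcoer v))
        ((hyfn.sub_const z).inner hpfn) fun k => ?_
      have h0 := hadjA k (p (d (σ k)))
      have h1 := integral_multiplier_mul_nonneg (hd (σ k)) (toH10 (φ (d (σ k)))) (y (d (σ k)))
        (p (d (σ k)))
      linarith
    rw [hμstar]
    linarith
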